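/- Let $N>3$ be an integer, $0<\mu<N$, $\lambda\ge 0$, $2_\mu^*:=\frac{2N-\mu}{N-2}$, and let $\Omega\subset\mathbb{R}^N$ be a bounded domain (a nonempty, bounded, connected open set). Write $u^+:=\max\{u,0\}$, let $H_0^1(\Omega)$ be the closure of $C_c^\infty(\Omega)$ in $H^1(\Omega)$, and let $\mathcal{D}^{1,2}(\mathbb{R}^N)$ be the completion of $C_c^\infty(\mathbb{R}^N)$ for the norm $\big(\int_{\mathbb{R}^N}|\nabla u|^2\,dx\big)^{1/2}$, regarded by the Sobolev embedding as a space of functions in $L^{2N/(N-2)}(\mathbb{R}^N)$. For $u\in\mathcal{D}^{1,2}(\mathbb{R}^N)$ put $$I_*(u):=\frac12\int_{\mathbb{R}^N}|\nabla u|^2\,dx-\frac{1}{2\cdot 2_\mu^*}\int_{\mathbb{R}^N}\int_{\mathbb{R}^N}\frac{(u^+(x))^{2_\mu^*}(u^+(y))^{2_\mu^*}}{|x-y|^\mu}\,dx\,dy,$$ $$\mathcal{N}_*:=\Big\{u\in\mathcal{D}^{1,2}(\mathbb{R}^N)\setminus\{0\}:\int_{\mathbb{R}^N}|\nabla u|^2\,dx=\int_{\mathbb{R}^N}\int_{\mathbb{R}^N}\frac{(u^+(x))^{2_\mu^*}(u^+(y))^{2_\mu^*}}{|x-y|^\mu}\,dx\,dy\Big\},\qquad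 m_*:=\inf_{\mathcal{N}_*}I_*,$$ and for $u\in H_0^1(\Omega)$ put $$I_*^\Omega(u):=\frac12\int_{\Omega}|\nabla u|^2\,dx+\frac{\lambda}{2}\int_\Omega u^2\,dx-\frac{1}{2\cdot 2_\mu^*}\int_{\Omega}\int_{\Omega}\frac{(u^+(x))^{2_\mu^*}(u^+(y))^{2_\mu^*}}{|x-y|^\mu}\,dx\,dy,$$ $$\mathcal{N}_*^\Omega:=\Big\{u\in H_0^1(\Omega)\setminus\{0\}:\int_{\Omega}|\nabla u|^2\,dx+\lambda\int_\Omega u^2\,dx=\int_{\Omega}\int_{\Omega}\frac{(u^+(x))^{2_\mu^*}(u^+(y))^{2_\mu^*}}{|x-y|^\mu}\,dx\,dy\Big\},\qquad m_*^\Omega:=\inf_{\mathcal{N}_*^\Omega}I_*^\Omega.$$ Then $\mathcal{N}_*$ and $\mathcal{N}_*^\Omega$ are nonempty, $I_*$ is bounded below on $\mathcal{N}_*$ and $I_*^\Omega$ on $\mathcal{N}_*^\Omega$ (so both infima are finite), $m_*^\Omega=m_*$, and $m_*^\Omega$ is not achieved: there is no $v\in\mathcal{N}_*^\Omega$ with $I_*^\Omega(v)=m_*^\Omega$.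 -/

import Mathlib

open MeasureTheory Filter Topology
open scoped ContDiff

noncomputable section

namespace Choquard

variable {N : ℕ}

/-- `φ ∈ C_c^∞(Ω)`. -/
def IsTest (Ω : Set (EuclideanSpace ℝ (Fin N))) (φ : EuclideanSpace ℝ (Fin N) → ℝ) : Prop :=
  ContDiff ℝ ∞ φ ∧ HasCompactSupport φ ∧ tsupport φ ⊆ Ω

/-- `g` is the weak (distributional) gradient of `u` on `Ω`. -/
def HasWeakGradient (Ω : Set (EuclideanSpace ℝ (Fin N))) (u : EuclideanSpace ℝ (Fin N) → ℝ)
    (g : EuclideanSpace ℝ (Fin N) → EuclideanSpace ℝ (Fin N)) : Prop :=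
  LocallyIntegrableOn u Ω volume ∧ LocallyIntegrableOn g Ω volume ∧
    ∀ φ : EuclideanSpace ℝ (Fin N) → ℝ, IsTest Ω φ → ∀ e : EuclideanSpace ℝ (Fin N),
      ∫ x in Ω, u x * fderiv ℝ φ x e = -∫ x in Ω, φ x * inner ℝ (g x) e

open Classical in
/-- The weak gradient `∇u` of `u` on `Ω`; it is unique up to equality almost everywhere in `Ω`
when it exists (the value `0` is used when there is none). -/
def weakGrad (Ω : Set (EuclideanSpace ℝ (Fin N))) (u : EuclideanSpace ℝ (Fin N) → ℝ) :
    EuclideanSpace ℝ (Fin N) → EuclideanSpace ℝ (Fin N) :=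
  if h : ∃ g, HasWeakGradient Ω u g then h.choose else 0

/-- `u` belongs to the closure of `C_c^∞(Ω)` for the norm
`|u|_{L^p(Ω)} + |∇u|_{L^2(Ω)}`: it lies in `L^p(Ω)`, has a weak gradient in `L^2(Ω)`, and is
approximated in this norm by test functions. Only the values of `u` on `Ω` matter. -/
def MemClosureTest (p : ENNReal) (Ω : Set (EuclideanSpace ℝ (Fin N)))
    (u : EuclideanSpace ℝ (Fin N) → ℝ) : Prop :=
  MemLp u p (volume.restrict Ω) ∧
  ∃ g : EuclideanSpace ℝ (Fin N) → EuclideanSpace ℝ (Fin N),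
    HasWeakGradient Ω u g ∧ MemLp g 2 (volume.restrict Ω) ∧
    ∃ φ : ℕ → EuclideanSpace ℝ (Fin N) → ℝ, (∀ n, IsTest Ω (φ n)) ∧
      Tendsto (fun n => eLpNorm (fun x => φ n x - u x) p (volume.restrict Ω)) atTop (𝓝 0) ∧
      Tendsto (fun n => eLpNorm (fun x => gradient (φ n) x - g x) 2 (volume.restrict Ω))
        atTop (𝓝 0)

/-- The Sobolev space `H_0^1(Ω)`: the closure of `C_c^∞(Ω)` in `H^1(Ω)`. -/
def MemH01 (Ω : Set (EuclideanSpace ℝ (Fin N))) (u : EuclideanSpace ℝ (Fin N) → ℝ) : Prop :=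
  MemClosureTest 2 Ω u

/-- The space `D^{1,2}(ℝ^N)`, the completion of `C_c^∞(ℝ^N)` for the norm `|∇u|_{L^2}`. It is
realized as a space of functions in the usual way: by the Sobolev inequality, a sequence of test
functions that is Cauchy for this norm converges in `L^{2N/(N-2)}(ℝ^N)`. -/
def MemD12 (u : EuclideanSpace ℝ (Fin N) → ℝ) : Prop :=
  MemClosureTest (ENNReal.ofReal (2 * (N : ℝ) / ((N : ℝ) - 2))) Set.univ u

/-- The critical exponent `2_μ^* = (2N - μ) / (N - 2)`. -/
def critExp (N : ℕ) (μ : ℝ) : ℝ := (2 * (N : ℝ) - μ) / ((N : ℝ) - 2)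

/-- `∫_Ω |∇u|^2 dx`. -/
def dirichlet (Ω : Set (EuclideanSpace ℝ (Fin N))) (u : EuclideanSpace ℝ (Fin N) → ℝ) : ℝ :=
  ∫ x in Ω, ‖weakGrad Ω u x‖ ^ 2

/-- `∫_Ω ∫_Ω (u⁺(x))^{2_μ^*} (u⁺(y))^{2_μ^*} / |x - y|^μ dx dy`, the Lebesgue integral of a
nonnegative function (finite on the function spaces above by the Hardy-Littlewood-Sobolev and the
Sobolev inequality). -/
def doubleInt (μ : ℝ) (Ω : Set (EuclideanSpace ℝ (Fin N)))
    (u : EuclideanSpace ℝ (Fin N) → ℝ) : ℝ :=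
  (∫⁻ x in Ω, ∫⁻ y in Ω, ENNReal.ofReal
    ((max (u x) 0) ^ critExp N μ * (max (u y) 0) ^ critExp N μ / ‖x - y‖ ^ μ)).toReal

/-- The functional `I_*` on `D^{1,2}(ℝ^N)`. -/
def energy (μ : ℝ) (u : EuclideanSpace ℝ (Fin N) → ℝ) : ℝ :=
  1 / 2 * dirichlet Set.univ u - 1 / (2 * critExp N μ) * doubleInt μ Set.univ u

/-- The Nehari manifold `N_*` of `I_*`: the nonzero `u` in `D^{1,2}(ℝ^N)` with
`I_*'(u)[u] = 0`. -/
def nehari (N : ℕ) (μ : ℝ) : Set (EuclideanSpace ℝ (Fin N) → ℝ) :=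
  {u | MemD12 u ∧ ¬ (u =ᵐ[volume] 0) ∧ dirichlet Set.univ u = doubleInt μ Set.univ u}

/-- The level `m_* = inf_{N_*} I_*`. -/
def level (N : ℕ) (μ : ℝ) : ℝ := sInf (energy μ '' nehari N μ)

/-- The functional `I_*^Ω` on `H_0^1(Ω)`. -/
def energyOn (μ lam : ℝ) (Ω : Set (EuclideanSpace ℝ (Fin N)))
    (u : EuclideanSpace ℝ (Fin N) → ℝ) : ℝ :=
  1 / 2 * dirichlet Ω u + lam / 2 * (∫ x in Ω, u x ^ 2)
    - 1 / (2 * critExp N μ) * doubleInt μ Ω u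

/-- The Nehari manifold `N_*^Ω` of `I_*^Ω`: the nonzero `u` in `H_0^1(Ω)` with
`(I_*^Ω)'(u)[u] = 0`. -/
def nehariOn (μ lam : ℝ) (Ω : Set (EuclideanSpace ℝ (Fin N))) :
    Set (EuclideanSpace ℝ (Fin N) → ℝ) :=
  {u | MemH01 Ω u ∧ ¬ (u =ᵐ[volume.restrict Ω] 0) ∧
    dirichlet Ω u + lam * (∫ x in Ω, u x ^ 2) = doubleInt μ Ω u}

/-- The level `m_*^Ω = inf_{N_*^Ω} I_*^Ω`. -/
def levelOn (μ lam : ℝ) (Ω : Set (EuclideanSpace ℝ (Fin N))) : ℝ :=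
  sInf (energyOn μ lam Ω '' nehariOn μ lam Ω)

end Choquard

end

/-!
Why the two levels agree and the level on `Ω` is not achieved.

Write `p = 2_μ^*`, `D` for the Dirichlet integral, `L = ∫ u²` and `B` for the double integral, and
let `Q` be the quadratic part: `D` on the whole space, `D + lam * L` on `Ω`. A function with
`Q, B > 0` has exactly one positive multiple on the Nehari manifold, of energy
`projLevel p Q B = (1/2 - 1/(2p)) (Q/B)^{1/(p-1)} Q`. This is increasing in `Q` and decreasing in
`B`, and every point of a Nehari manifold has energy `projLevel p B B`. On a Nehari manifold `Q > 0`
by the Sobolev inequality, so `B` is positive, and hence the double integral is not the value `0`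
given to an infinite integral: the Hardy-Littlewood-Sobolev inequality is never needed.

* `level ≤ levelOn`: extension by zero maps `H_0^1(Ω)` into `D^{1,2}`, preserves `D` and `B`, and
  drops the nonnegative term `lam * L` (`ClosureTestWith.extend`, `level_le_levelOn`).
* `levelOn ≤ level`: a test function on the whole space can be concentrated at a point of `Ω` by a
  dilation. With `p (N - 2) = 2N - μ`, this multiplies `D` by some `a` and `B` by `a ^ p`, which does
  not change `projLevel`, while the contribution of `L` tends to `0`
  (`levelOn_le_projLevel_of_isTest`). An element of `D^{1,2}` is a limit of test functions, along
  which `D` converges and `B` is lower semicontinuous by Fatou's lemma (`levelOn_le_level`).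
* The level is not achieved: let `w` be the extension by zero of a minimizer, and let `φ ≥ 0` be a
  test function equal to `1` near the bounded set `Ω`. The gradients of `w` and `φ` live on disjoint
  sets, so `D (w + tφ) = D w + t² D φ`. By Bernoulli's inequality `B (w + tφ) ≥ B w + c t` with
  `c > 0` (`exists_doubleInt_add_ge`). For small `t` the projection of `w + tφ` has energy below the
  minimum (`energyOn_ne_level`). This replaces the regularity theory and the strong maximum principle
  that are usually invoked for the Euler-Lagrange equation.
-/

namespace Choquard

variable {N : ℕ}

/-! ### Closures of the test functions -/

/-- `u` is the limit of test functions on `Ω` for the norm `|u|_{L^p(Ω)} + |∇u|_{L^2(Ω)}`, with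
weak gradient `g`: the predicate `MemClosureTest` with the gradient made explicit. -/
structure ClosureTestWith (p : ENNReal) (Ω : Set (EuclideanSpace ℝ (Fin N)))
    (u : EuclideanSpace ℝ (Fin N) → ℝ)
    (g : EuclideanSpace ℝ (Fin N) → EuclideanSpace ℝ (Fin N)) : Prop where
  memLp : MemLp u p (volume.restrict Ω)
  hasWeakGradient : HasWeakGradient Ω u g
  memLp_grad : MemLp g 2 (volume.restrict Ω)
  approx : ∃ φ : ℕ → EuclideanSpace ℝ (Fin N) → ℝ, (∀ n, IsTest Ω (φ n)) ∧
      Tendsto (fun n => eLpNorm (fun x => φ n x - u x) p (volume.restrict Ω)) atTop (𝓝 0) ∧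
      Tendsto (fun n => eLpNorm (fun x => gradient (φ n) x - g x) 2 (volume.restrict Ω))
        atTop (𝓝 0)

lemma memClosureTest_iff {p : ENNReal} {Ω : Set (EuclideanSpace ℝ (Fin N))}
    {u : EuclideanSpace ℝ (Fin N) → ℝ} :
    MemClosureTest p Ω u ↔ ∃ g, ClosureTestWith p Ω u g :=
  ⟨fun ⟨h1, g, h2, h3, h4⟩ => ⟨g, h1, h2, h3, h4⟩, fun ⟨g, h⟩ => ⟨h.1, g, h.2, h.3, h.4⟩⟩

/-! ### Test functions -/

section IsTest

variable {Ω : Set (EuclideanSpace ℝ (Fin N))} {φ ψ : EuclideanSpace ℝ (Fin N) → ℝ}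

lemma IsTest.mono {Ω' : Set (EuclideanSpace ℝ (Fin N))} (h : IsTest Ω φ) (hs : Ω ⊆ Ω') :
    IsTest Ω' φ := ⟨h.1, h.2.1, h.2.2.trans hs⟩

lemma IsTest.to_univ (h : IsTest Ω φ) : IsTest Set.univ φ := h.mono (Set.subset_univ _)

lemma IsTest.differentiable (h : IsTest Ω φ) : Differentiable ℝ φ := h.1.differentiable (by simp)

lemma IsTest.continuous (h : IsTest Ω φ) : Continuous φ := h.1.continuous

lemma IsTest.eq_zero (h : IsTest Ω φ) {x : EuclideanSpace ℝ (Fin N)} (hx : x ∉ Ω) : φ x = 0 :=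
  image_eq_zero_of_notMem_tsupport fun hx' => hx (h.2.2 hx')

lemma tsupport_gradient_subset (φ : EuclideanSpace ℝ (Fin N) → ℝ) :
    tsupport (gradient φ) ⊆ tsupport φ := by
  refine closure_minimal (fun x hx => ?_) (isClosed_tsupport φ)
  refine tsupport_fderiv_subset ℝ (subset_tsupport _ ?_)
  simp only [Function.mem_support, gradient] at hx ⊢
  contrapose! hx
  simp [hx]

lemma IsTest.gradient_eq_zero (h : IsTest Ω φ) {x : EuclideanSpace ℝ (Fin N)} (hx : x ∉ Ω) :
    gradient φ x = 0 :=
  image_eq_zero_of_notMem_tsupport fun hx' => hx (h.2.2 (tsupport_gradient_subset φ hx'))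

lemma IsTest.continuous_fderiv (h : IsTest Ω φ) : Continuous (fderiv ℝ φ) :=
  h.1.continuous_fderiv (by simp)

lemma IsTest.continuous_gradient (h : IsTest Ω φ) : Continuous (gradient φ) :=
  (InnerProductSpace.toDual ℝ _).symm.continuous.comp h.continuous_fderiv

lemma IsTest.hasCompactSupport_gradient (h : IsTest Ω φ) : HasCompactSupport (gradient φ) :=
  h.2.1.of_isClosed_subset (isClosed_tsupport _) (tsupport_gradient_subset φ)

lemma IsTest.memLp (h : IsTest Ω φ) (p : ENNReal) : MemLp φ p volume :=
  h.continuous.memLp_of_hasCompactSupport h.2.1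

lemma IsTest.memLp_gradient (h : IsTest Ω φ) (p : ENNReal) : MemLp (gradient φ) p volume :=
  h.continuous_gradient.memLp_of_hasCompactSupport h.hasCompactSupport_gradient

lemma IsTest.add (h : IsTest Ω φ) (h' : IsTest Ω ψ) : IsTest Ω (fun x => φ x + ψ x) :=
  ⟨h.1.add h'.1, h.2.1.add h'.2.1, (tsupport_add φ ψ).trans (Set.union_subset h.2.2 h'.2.2)⟩

lemma IsTest.const_mul (h : IsTest Ω φ) (c : ℝ) : IsTest Ω (fun x => c * φ x) :=
  ⟨contDiff_const.mul h.1, h.2.1.mul_left (f := fun _ => c),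
    (tsupport_mul_subset_right (f := fun _ => c)).trans h.2.2⟩

lemma IsTest.gradient_add (h : IsTest Ω φ) (h' : IsTest Ω ψ) (x : EuclideanSpace ℝ (Fin N)) :
    gradient (fun x => φ x + ψ x) x = gradient φ x + gradient ψ x := by
  simp only [gradient]
  rw [fderiv_fun_add (h.differentiable x) (h'.differentiable x), map_add]

lemma IsTest.gradient_const_mul (h : IsTest Ω φ) (c : ℝ) (x : EuclideanSpace ℝ (Fin N)) :
    gradient (fun x => c * φ x) x = c • gradient φ x := by
  simp only [gradient]
  rw [fderiv_const_mul (h.differentiable x), map_smul]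

lemma norm_gradient (φ : EuclideanSpace ℝ (Fin N) → ℝ) (x : EuclideanSpace ℝ (Fin N)) :
    ‖gradient φ x‖ = ‖fderiv ℝ φ x‖ := by
  simp [gradient]

lemma integrable_smul_of_tsupport_subset {F : Type*} [NormedAddCommGroup F] [NormedSpace ℝ F]
    {f : EuclideanSpace ℝ (Fin N) → F} (hf : LocallyIntegrableOn f Ω volume)
    (hc : Continuous φ) (hk : HasCompactSupport φ) (hs : tsupport φ ⊆ Ω) :
    Integrable (fun x => φ x • f x) volume := by
  have h1 : IntegrableOn f (tsupport φ) volume := hf.integrableOn_compact_subset hs hk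
  have h2 : IntegrableOn (fun x => φ x • f x) (tsupport φ) volume :=
    h1.continuousOn_smul hc.continuousOn hk
  refine (integrableOn_iff_integrable_of_support_subset fun x hx => ?_).1 h2
  refine subset_tsupport _ fun h0 => hx ?_
  simp [h0]

lemma integral_mul_fderiv_eq_neg (h : IsTest Set.univ φ) (h' : IsTest Set.univ ψ)
    (e : EuclideanSpace ℝ (Fin N)) :
    ∫ x, φ x * fderiv ℝ ψ x e = -∫ x, ψ x * inner ℝ (gradient φ x) e := by
  have c1 : Continuous fun x => fderiv ℝ ψ x e := h'.continuous_fderiv.clm_apply continuous_const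
  have c2 : Continuous fun x => fderiv ℝ φ x e := h.continuous_fderiv.clm_apply continuous_const
  rw [integral_mul_fderiv_eq_neg_fderiv_mul_of_integrable
    ((c2.mul h'.continuous).integrable_of_hasCompactSupport h'.2.1.mul_left)
    ((h.continuous.mul c1).integrable_of_hasCompactSupport h.2.1.mul_right)
    ((h.continuous.mul h'.continuous).integrable_of_hasCompactSupport h.2.1.mul_right)
    (fun x _ => h.differentiable x) (fun x _ => h'.differentiable x)]
  simp only [inner_gradient_left, mul_comm]

lemma IsTest.setIntegral_mul (h : IsTest Ω φ) (f : EuclideanSpace ℝ (Fin N) → ℝ) :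
    ∫ x in Ω, φ x * f x = ∫ x, φ x * f x :=
  setIntegral_eq_integral_of_forall_compl_eq_zero fun x hx => by simp [h.eq_zero hx]

lemma IsTest.setIntegral_mul_fderiv (h : IsTest Ω φ) (f : EuclideanSpace ℝ (Fin N) → ℝ)
    (e : EuclideanSpace ℝ (Fin N)) :
    ∫ x in Ω, f x * fderiv ℝ φ x e = ∫ x, f x * fderiv ℝ φ x e :=
  setIntegral_eq_integral_of_forall_compl_eq_zero fun x hx => by
    rw [← inner_gradient_left, h.gradient_eq_zero hx]; simp

lemma IsTest.hasWeakGradient (h : IsTest Set.univ φ) (Ω : Set (EuclideanSpace ℝ (Fin N))) :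
    HasWeakGradient Ω φ (gradient φ) := by
  refine ⟨h.continuous.locallyIntegrable.locallyIntegrableOn _,
    h.continuous_gradient.locallyIntegrable.locallyIntegrableOn _, fun ψ hψ e => ?_⟩
  rw [hψ.setIntegral_mul_fderiv, hψ.setIntegral_mul, integral_mul_fderiv_eq_neg h hψ.to_univ]

lemma IsTest.closureTestWith (h : IsTest Ω φ) (p : ENNReal) :
    ClosureTestWith p Ω φ (gradient φ) :=
  ⟨(h.memLp p).restrict _, h.to_univ.hasWeakGradient _, (h.memLp_gradient 2).restrict _,
    fun _ => φ, fun _ => h, by simp, by simp⟩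

end IsTest

/-! ### Weak gradients -/

section WeakGradient

variable {Ω : Set (EuclideanSpace ℝ (Fin N))} {u v : EuclideanSpace ℝ (Fin N) → ℝ}
  {g h : EuclideanSpace ℝ (Fin N) → EuclideanSpace ℝ (Fin N)}

lemma HasWeakGradient.ae_eq (hΩ : IsOpen Ω) (hg : HasWeakGradient Ω u g)
    (hh : HasWeakGradient Ω u h) : g =ᵐ[volume.restrict Ω] h := by
  have key := hΩ.ae_eq_zero_of_integral_contDiff_smul_eq_zero (μ := volume)
    (f := fun x => g x - h x) (hg.2.1.sub hh.2.1) ?_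
  · rw [Filter.EventuallyEq, ae_restrict_iff' hΩ.measurableSet]
    filter_upwards [key] with x hx hxΩ using sub_eq_zero.1 (hx hxΩ)
  · intro φ h1 h2 h3
    have hφ : IsTest Ω φ := ⟨h1, h2, h3⟩
    have ig := integrable_smul_of_tsupport_subset hg.2.1 h1.continuous h2 h3
    have ih := integrable_smul_of_tsupport_subset hh.2.1 h1.continuous h2 h3
    simp only [smul_sub]
    rw [integral_sub ig ih, sub_eq_zero]
    refine ext_inner_right ℝ fun e => ?_
    have e1 := hg.2.2 φ hφ e
    have e2 := hh.2.2 φ hφ e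
    rw [e1, neg_inj, hφ.setIntegral_mul, hφ.setIntegral_mul] at e2
    have aux : ∀ f : EuclideanSpace ℝ (Fin N) → EuclideanSpace ℝ (Fin N),
        Integrable (fun x => φ x • f x) volume →
        inner ℝ (∫ x, φ x • f x) e = ∫ x, φ x * inner ℝ (f x) e := fun f hf => by
      rw [real_inner_comm, ← integral_inner hf]
      refine integral_congr_ae (ae_of_all _ fun x => ?_)
      simp only
      rw [inner_smul_right, real_inner_comm]
    rw [aux g ig, aux h ih, e2]

lemma HasWeakGradient.dirichlet_eq (hΩ : IsOpen Ω) (hg : HasWeakGradient Ω u g) :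
    dirichlet Ω u = ∫ x in Ω, ‖g x‖ ^ 2 := by
  have hex : ∃ g, HasWeakGradient Ω u g := ⟨g, hg⟩
  have h1 : HasWeakGradient Ω u (weakGrad Ω u) := by
    rw [weakGrad, dif_pos hex]; exact hex.choose_spec
  refine integral_congr_ae ?_
  filter_upwards [h1.ae_eq hΩ hg] with x hx
  rw [hx]

lemma HasWeakGradient.const_mul (hg : HasWeakGradient Ω u g) (c : ℝ) :
    HasWeakGradient Ω (fun x => c * u x) (fun x => c • g x) := by
  refine ⟨hg.1.smul c, hg.2.1.smul c, fun φ hφ e => ?_⟩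
  simp only [mul_assoc, inner_smul_left, RCLike.conj_to_real, mul_left_comm _ c]
  rw [integral_const_mul, integral_const_mul, hg.2.2 φ hφ e, mul_neg]

lemma HasWeakGradient.add (hu : HasWeakGradient Ω u g) (hv : HasWeakGradient Ω v h) :
    HasWeakGradient Ω (fun x => u x + v x) (fun x => g x + h x) := by
  refine ⟨hu.1.add hv.1, hu.2.1.add hv.2.1, fun φ hφ e => ?_⟩
  have a1 : ∀ {w : EuclideanSpace ℝ (Fin N) → ℝ}, LocallyIntegrableOn w Ω volume →
      Integrable (fun x => w x * fderiv ℝ φ x e) volume := fun {w} hw => by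
    have := integrable_smul_of_tsupport_subset (φ := fun x => fderiv ℝ φ x e) hw
      (hφ.continuous_fderiv.clm_apply continuous_const) (hφ.2.1.fderiv_apply ℝ e)
      ((tsupport_fderiv_apply_subset ℝ e).trans hφ.2.2)
    simpa [mul_comm] using this
  have a2 : ∀ {k : EuclideanSpace ℝ (Fin N) → EuclideanSpace ℝ (Fin N)},
      LocallyIntegrableOn k Ω volume →
      Integrable (fun x => φ x * inner ℝ (k x) e) volume := fun {k} hk => by
    have := integrable_smul_of_tsupport_subset hk hφ.continuous hφ.2.1 hφ.2.2
    simpa [inner_smul_left] using this.inner_const (𝕜 := ℝ) e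
  simp only [add_mul, inner_add_left, mul_add]
  rw [integral_add (a1 hu.1).restrict (a1 hv.1).restrict,
    integral_add (a2 hu.2.1).restrict (a2 hv.2.1).restrict, hu.2.2 φ hφ e, hv.2.2 φ hφ e]
  ring

end WeakGradient

section Closure

variable {p : ENNReal} {Ω : Set (EuclideanSpace ℝ (Fin N))} {u v : EuclideanSpace ℝ (Fin N) → ℝ}
  {g h : EuclideanSpace ℝ (Fin N) → EuclideanSpace ℝ (Fin N)}

lemma ClosureTestWith.const_mul (hu : ClosureTestWith p Ω u g) (c : ℝ) :
    ClosureTestWith p Ω (fun x => c * u x) (fun x => c • g x) := by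
  obtain ⟨φ, h1, h2, h3⟩ := hu.approx
  refine ⟨hu.memLp.const_mul c, hu.hasWeakGradient.const_mul c, hu.memLp_grad.const_smul c,
    fun n x => c * φ n x, fun n => (h1 n).const_mul c, ?_, ?_⟩
  · have : ∀ n, eLpNorm (fun x => c * φ n x - c * u x) p (volume.restrict Ω)
        = ‖c‖ₑ * eLpNorm (fun x => φ n x - u x) p (volume.restrict Ω) := fun n => by
      rw [← eLpNorm_const_smul]; congr 1; ext x; simp [mul_sub]
    simp only [this]
    simpa using ENNReal.Tendsto.const_mul h2 (Or.inr enorm_ne_top)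
  · have : ∀ n, eLpNorm (fun x => gradient (fun x => c * φ n x) x - c • g x) 2
        (volume.restrict Ω)
        = ‖c‖ₑ * eLpNorm (fun x => gradient (φ n) x - g x) 2 (volume.restrict Ω) := fun n => by
      rw [← eLpNorm_const_smul]; congr 1; ext1 x
      rw [(h1 n).gradient_const_mul, Pi.smul_apply, smul_sub]
    simp only [this]
    simpa using ENNReal.Tendsto.const_mul h3 (Or.inr enorm_ne_top)

lemma ClosureTestWith.add_test (hu : ClosureTestWith p Ω u g)
    (hv : IsTest Ω v) :
    ClosureTestWith p Ω (fun x => u x + v x) (fun x => g x + gradient v x) := by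
  obtain ⟨φ, h1, h2, h3⟩ := hu.approx
  refine ⟨hu.memLp.add ((hv.memLp p).restrict _),
    hu.hasWeakGradient.add (hv.to_univ.hasWeakGradient Ω),
    hu.memLp_grad.add ((hv.memLp_gradient 2).restrict _),
    fun n x => φ n x + v x, fun n => (h1 n).add hv, ?_, ?_⟩
  · simpa using h2
  · simpa [(h1 _).gradient_add hv] using h3

end Closure

/-! ### The Sobolev inequality and extension by zero -/

/-- The Sobolev exponent `2^* = 2N / (N - 2)`. -/
noncomputable def sobolevExp (N : ℕ) : ENNReal := ENNReal.ofReal (2 * (N : ℝ) / ((N : ℝ) - 2))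

lemma two_le_sobolevExp (hN : 3 < N) : 2 ≤ sobolevExp N := by
  have h3 : (3 : ℝ) < N := by exact_mod_cast hN
  rw [sobolevExp, ← ENNReal.ofReal_ofNat 2]
  refine ENNReal.ofReal_le_ofReal ?_
  rw [le_div_iff₀ (by linarith)]
  linarith

lemma exists_sobolev_const (hN : 3 < N) : ∃ C : ENNReal, C ≠ ⊤ ∧
    ∀ φ : EuclideanSpace ℝ (Fin N) → ℝ, IsTest Set.univ φ →
      eLpNorm φ (sobolevExp N) volume ≤ C * eLpNorm (gradient φ) 2 volume := by
  have h3 : (3 : ℝ) < N := by exact_mod_cast hN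
  refine ⟨eLpNormLESNormFDerivOfEqInnerConst
    (volume : Measure (EuclideanSpace ℝ (Fin N))) 2, ENNReal.coe_ne_top, fun φ hφ => ?_⟩
  have h := eLpNorm_le_eLpNorm_fderiv_of_eq_inner (volume : Measure (EuclideanSpace ℝ (Fin N)))
    (hφ.1.of_le (by simp) : ContDiff ℝ 1 φ) hφ.2.1 (p := 2)
    (p' := (2 * (N : ℝ) / ((N : ℝ) - 2)).toNNReal) (by norm_num)
    (by simp; omega) (by
      rw [Real.coe_toNNReal _ (div_nonneg (by linarith) (by linarith)), finrank_euclideanSpace_fin]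
      have : (N : ℝ) - 2 ≠ 0 := by linarith
      have : (N : ℝ) ≠ 0 := by linarith
      field_simp
      norm_num
      ring)
  refine h.trans_eq ?_
  congr 1
  exact eLpNorm_congr_norm_ae (ae_of_all _ fun x => (norm_gradient φ x).symm)

/-- The Sobolev inequality passes to limits of test functions, whatever the Lebesgue space in which
the functions converge. -/
lemma sobolev_limit {C : ENNReal} (hC : C ≠ ⊤)
    (hS : ∀ φ : EuclideanSpace ℝ (Fin N) → ℝ, IsTest Set.univ φ →
      eLpNorm φ (sobolevExp N) volume ≤ C * eLpNorm (gradient φ) 2 volume)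
    {q : ENNReal} (hq : q ≠ 0) {φ : ℕ → EuclideanSpace ℝ (Fin N) → ℝ}
    (hφ : ∀ n, IsTest Set.univ (φ n)) {u : EuclideanSpace ℝ (Fin N) → ℝ}
    (hu : AEStronglyMeasurable u volume)
    {g : EuclideanSpace ℝ (Fin N) → EuclideanSpace ℝ (Fin N)}
    (hg : AEStronglyMeasurable g volume)
    (h1 : Tendsto (fun n => eLpNorm (fun x => φ n x - u x) q volume) atTop (𝓝 0))
    (h2 : Tendsto (fun n => eLpNorm (fun x => gradient (φ n) x - g x) 2 volume) atTop (𝓝 0)) :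
    eLpNorm u (sobolevExp N) volume ≤ C * eLpNorm g 2 volume := by
  obtain ⟨ns, hns, hae⟩ := (tendstoInMeasure_of_tendsto_eLpNorm hq
    (fun n => ((hφ n).memLp q).aestronglyMeasurable) hu h1).exists_seq_tendsto_ae
  have hF := Lp.eLpNorm_lim_le_liminf_eLpNorm (p := sobolevExp N) (μ := volume)
    (f := fun n => φ (ns n)) (fun n => ((hφ _).memLp q).aestronglyMeasurable) u hae
  refine hF.trans ?_
  have hle : ∀ n, eLpNorm (φ (ns n)) (sobolevExp N) volume ≤
      C * (eLpNorm (fun x => gradient (φ (ns n)) x - g x) 2 volume + eLpNorm g 2 volume) := by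
    intro n
    refine (hS _ (hφ _)).trans ?_
    gcongr
    have : gradient (φ (ns n)) = (fun x => gradient (φ (ns n)) x - g x) + g := by
      ext1 x; simp
    conv_lhs => rw [this]
    exact eLpNorm_add_le ((((hφ _).memLp_gradient 2).aestronglyMeasurable).sub hg) hg (by norm_num)
  have hlim : Tendsto (fun n => C * (eLpNorm (fun x => gradient (φ (ns n)) x - g x) 2 volume
      + eLpNorm g 2 volume)) atTop (𝓝 (C * (0 + eLpNorm g 2 volume))) :=
    ENNReal.Tendsto.const_mul ((h2.comp hns.tendsto_atTop).add_const _) (Or.inr hC)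
  rw [zero_add] at hlim
  rw [← hlim.liminf_eq]
  exact liminf_le_liminf (Eventually.of_forall hle)

lemma ClosureTestWith.dirichlet_pos (hN : 3 < N) {u : EuclideanSpace ℝ (Fin N) → ℝ}
    {g : EuclideanSpace ℝ (Fin N) → EuclideanSpace ℝ (Fin N)}
    (h : ClosureTestWith (sobolevExp N) Set.univ u g) (hu : ¬ u =ᵐ[volume] 0) :
    0 < dirichlet Set.univ u := by
  obtain ⟨C, hC, hS⟩ := exists_sobolev_const hN
  obtain ⟨φ, h1, h2, h3⟩ := h.approx
  have h4 := h.memLp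
  have h5 := h.memLp_grad
  rw [Measure.restrict_univ] at h2 h3 h4 h5
  have h0 : sobolevExp N ≠ 0 := fun h0 => by simpa [h0] using two_le_sobolevExp hN
  have hle := sobolev_limit hC hS h0 h1 h4.1 h5.1 h2 h3
  rw [h.hasWeakGradient.dirichlet_eq isOpen_univ, Measure.restrict_univ]
  refine lt_of_le_of_ne (integral_nonneg fun x => by positivity) fun heq => hu ?_
  rw [eq_comm, integral_eq_zero_iff_of_nonneg (fun x => by positivity)
    h5.norm.integrable_sq] at heq
  have hg : g =ᵐ[volume] 0 := by
    filter_upwards [heq] with x hx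
    simpa using hx
  rw [eLpNorm_congr_ae hg, eLpNorm_zero, mul_zero, nonpos_iff_eq_zero,
    eLpNorm_eq_zero_iff h4.1 h0] at hle
  exact hle

lemma indicator_sub_of_eq_zero {F : Type*} [AddGroup F] {α : Type*} {Ω : Set α}
    {f w : α → F} (hf : ∀ x ∉ Ω, f x = 0) :
    (fun x => f x - Ω.indicator w x) = Ω.indicator (fun x => f x - w x) := by
  ext1 x
  by_cases hx : x ∈ Ω <;> simp [hx, hf]

/-- Pairing with a fixed square integrable function is continuous for the `L²` seminorm. -/
lemma tendsto_integral_inner_of_tendsto_eLpNorm {α F : Type*} [MeasurableSpace α] {ν : Measure α}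
    [NormedAddCommGroup F] [InnerProductSpace ℝ F]
    {f : ℕ → α → F} {w k : α → F} (hf : ∀ n, MemLp (f n) 2 ν) (hw : MemLp w 2 ν)
    (hk : MemLp k 2 ν)
    (h : Tendsto (fun n => eLpNorm (fun x => f n x - w x) 2 ν) atTop (𝓝 0)) :
    Tendsto (fun n => ∫ x, inner ℝ (f n x) (k x) ∂ν) atTop (𝓝 (∫ x, inner ℝ (w x) (k x) ∂ν)) := by
  have key : ∀ {a : α → F} (ha : MemLp a 2 ν),
      ∫ x, inner ℝ (a x) (k x) ∂ν = inner ℝ (ha.toLp a) (hk.toLp k) := fun {a} ha => by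
    rw [L2.inner_def]
    refine integral_congr_ae ?_
    filter_upwards [ha.coeFn_toLp, hk.coeFn_toLp] with x h1 h2
    rw [h1, h2]
  simp only [key (hf _), key hw]
  refine Tendsto.inner ?_ tendsto_const_nhds
  rw [Lp.tendsto_Lp_iff_tendsto_eLpNorm'']
  exact h

/-- Extension by zero maps `H_0^1(Ω)` into `D^{1,2}(ℝ^N)` and commutes with the weak gradient. -/
lemma ClosureTestWith.extend (hN : 3 < N) {Ω : Set (EuclideanSpace ℝ (Fin N))} (hΩ : IsOpen Ω)
    {v : EuclideanSpace ℝ (Fin N) → ℝ}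
    {g : EuclideanSpace ℝ (Fin N) → EuclideanSpace ℝ (Fin N)} (h : ClosureTestWith 2 Ω v g) :
    ClosureTestWith (sobolevExp N) Set.univ (Ω.indicator v) (Ω.indicator g) := by
  have hm := hΩ.measurableSet
  obtain ⟨C, hC, hS⟩ := exists_sobolev_const hN
  obtain ⟨φ, h1, h2, h3⟩ := h.approx
  have hw : MemLp (Ω.indicator v) 2 volume := (memLp_indicator_iff_restrict hm).2 h.memLp
  have hG : MemLp (Ω.indicator g) 2 volume := (memLp_indicator_iff_restrict hm).2 h.memLp_grad
  have h1' : ∀ n, IsTest Set.univ (φ n) := fun n => (h1 n).to_univ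
  have h2' : Tendsto (fun n => eLpNorm (fun x => φ n x - Ω.indicator v x) 2 volume)
      atTop (𝓝 0) := by
    refine h2.congr fun n => ?_
    rw [indicator_sub_of_eq_zero fun x hx => (h1 n).eq_zero hx,
      eLpNorm_indicator_eq_eLpNorm_restrict hm]
  have h3' : Tendsto (fun n => eLpNorm (fun x => gradient (φ n) x - Ω.indicator g x) 2 volume)
      atTop (𝓝 0) := by
    refine h3.congr fun n => ?_
    rw [indicator_sub_of_eq_zero fun x hx => (h1 n).gradient_eq_zero hx,
      eLpNorm_indicator_eq_eLpNorm_restrict hm]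
  -- the Sobolev inequality for `φ n - φ m`, in the limit `m → ∞`
  have hdiff : ∀ n, eLpNorm (fun x => φ n x - Ω.indicator v x) (sobolevExp N) volume ≤
      C * eLpNorm (fun x => gradient (φ n) x - Ω.indicator g x) 2 volume := fun n => by
    have ht : ∀ m, IsTest Set.univ (fun x => φ n x + (-1) * φ m x) :=
      fun m => (h1' n).add ((h1' m).const_mul (-1))
    refine sobolev_limit hC hS two_ne_zero ht
      (((h1' n).memLp 2).aestronglyMeasurable.sub hw.1)
      (((h1' n).memLp_gradient 2).aestronglyMeasurable.sub hG.1) ?_ ?_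
    · refine h2'.congr fun m => ?_
      rw [← eLpNorm_neg]
      congr 1
      ext1 x
      simp only [Pi.neg_apply, Pi.sub_apply]
      ring
    · refine h3'.congr fun m => ?_
      rw [← eLpNorm_neg]
      congr 1
      ext1 x
      rw [(h1' n).gradient_add ((h1' m).const_mul (-1)), (h1' m).gradient_const_mul, Pi.neg_apply]
      module
  have hlim : Tendsto (fun n => eLpNorm (fun x => φ n x - Ω.indicator v x) (sobolevExp N) volume)
      atTop (𝓝 0) := by
    have : Tendsto (fun n => C * eLpNorm (fun x => gradient (φ n) x - Ω.indicator g x) 2 volume)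
        atTop (𝓝 (C * 0)) := ENNReal.Tendsto.const_mul h3' (Or.inr hC)
    rw [mul_zero] at this
    exact tendsto_of_tendsto_of_tendsto_of_le_of_le tendsto_const_nhds this (fun _ => zero_le)
      hdiff
  refine ⟨?_, ⟨?_, ?_, fun ψ hψ e => ?_⟩, ?_, φ, h1', ?_, ?_⟩
  · rw [Measure.restrict_univ]
    have hd : MemLp (fun x => φ 0 x - Ω.indicator v x) (sobolevExp N) volume :=
      ⟨((h1' 0).memLp 2).aestronglyMeasurable.sub hw.1, (hdiff 0).trans_lt
        (ENNReal.mul_lt_top hC.lt_top (((h1' 0).memLp_gradient 2).sub hG).2)⟩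
    convert ((h1' 0).memLp _).sub hd using 1
    ext1 x
    simp
  · exact (hw.locallyIntegrable (by norm_num)).locallyIntegrableOn _
  · exact (hG.locallyIntegrable (by norm_num)).locallyIntegrableOn _
  · rw [Measure.restrict_univ]
    have c1 : MemLp (fun x => fderiv ℝ ψ x e) 2 volume :=
      (hψ.continuous_fderiv.clm_apply continuous_const).memLp_of_hasCompactSupport
        (hψ.2.1.fderiv_apply ℝ e)
    have c2 : MemLp (fun x => ψ x • e) 2 volume :=
      (hψ.continuous.smul continuous_const).memLp_of_hasCompactSupport hψ.2.1.smul_right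
    have l1 := tendsto_integral_inner_of_tendsto_eLpNorm (fun n => (h1' n).memLp 2) hw c1 h2'
    have l2 := tendsto_integral_inner_of_tendsto_eLpNorm (fun n => (h1' n).memLp_gradient 2) hG c2
      h3'
    have l3 : ∀ n, ∫ x, inner ℝ (φ n x) (fderiv ℝ ψ x e)
        = -∫ x, inner ℝ (gradient (φ n) x) (ψ x • e) := fun n => by
      have := integral_mul_fderiv_eq_neg (h1' n) hψ e
      simpa [inner_smul_right, mul_comm] using this
    simp only [l3] at l1
    have := tendsto_nhds_unique l1 l2.neg
    simpa [inner_smul_right, mul_comm] using this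
  · rwa [Measure.restrict_univ]
  · rwa [Measure.restrict_univ]
  · rwa [Measure.restrict_univ]

lemma ClosureTestWith.dirichlet_indicator (hN : 3 < N) {Ω : Set (EuclideanSpace ℝ (Fin N))}
    (hΩ : IsOpen Ω) {v : EuclideanSpace ℝ (Fin N) → ℝ}
    {g : EuclideanSpace ℝ (Fin N) → EuclideanSpace ℝ (Fin N)} (h : ClosureTestWith 2 Ω v g) :
    dirichlet Set.univ (Ω.indicator v) = dirichlet Ω v := by
  rw [(h.extend hN hΩ).hasWeakGradient.dirichlet_eq isOpen_univ, h.hasWeakGradient.dirichlet_eq hΩ,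
    Measure.restrict_univ, ← integral_indicator hΩ.measurableSet]
  refine integral_congr_ae (ae_of_all _ fun x => ?_)
  by_cases hx : x ∈ Ω <;> simp [hx]

/-! ### The Riesz form -/

/-- The Riesz kernel `|z|^{-μ}` with values in `[0, ∞]`. Its value at the origin is `0`, as in the
integrand of `doubleInt`; this concerns only the diagonal, a null set. -/
noncomputable def rieszKernel (μ : ℝ) (z : EuclideanSpace ℝ (Fin N)) : ENNReal :=
  ENNReal.ofReal (‖z‖ ^ μ)⁻¹

/-- The Riesz potential `∫ h(y) |x - y|^{-μ} dy`. -/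
noncomputable def rieszPotential (μ : ℝ) (h : EuclideanSpace ℝ (Fin N) → ENNReal)
    (x : EuclideanSpace ℝ (Fin N)) : ENNReal :=
  ∫⁻ y, h y * rieszKernel μ (x - y)

/-- The bilinear form `∫∫ f(x) h(y) |x - y|^{-μ} dx dy` on nonnegative functions. -/
noncomputable def rieszForm (μ : ℝ) (f h : EuclideanSpace ℝ (Fin N) → ENNReal) : ENNReal :=
  ∫⁻ x, ∫⁻ y, f x * h y * rieszKernel μ (x - y)

section RieszForm

variable {μ : ℝ} {f f' h h' : EuclideanSpace ℝ (Fin N) → ENNReal}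

lemma measurable_rieszKernel (μ : ℝ) :
    Measurable (rieszKernel μ : EuclideanSpace ℝ (Fin N) → ENNReal) :=
  (measurable_norm.pow_const μ).inv.ennreal_ofReal

lemma rieszKernel_sub_comm (x y : EuclideanSpace ℝ (Fin N)) :
    rieszKernel μ (x - y) = rieszKernel μ (y - x) := by
  simp only [rieszKernel, norm_sub_rev]

lemma rieszKernel_pos {z : EuclideanSpace ℝ (Fin N)} (hz : z ≠ 0) : 0 < rieszKernel μ z :=
  ENNReal.ofReal_pos.2 (inv_pos.2 (Real.rpow_pos_of_pos (norm_pos_iff.2 hz) _))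

lemma rieszForm_mono (hf : ∀ x, f x ≤ f' x) (hh : ∀ x, h x ≤ h' x) :
    rieszForm μ f h ≤ rieszForm μ f' h' :=
  lintegral_mono fun x => lintegral_mono fun y => by
    gcongr
    · exact hf x
    · exact hh y

lemma rieszPotential_congr_ae (hh : h =ᵐ[volume] h') :
    (rieszPotential μ h : EuclideanSpace ℝ (Fin N) → ENNReal) = rieszPotential μ h' := by
  ext1 x
  refine lintegral_congr_ae ?_
  filter_upwards [hh] with y hy
  rw [hy]

lemma measurable_rieszPotential (hh : AEMeasurable h volume) :
    Measurable (rieszPotential μ h) := by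
  rw [rieszPotential_congr_ae hh.ae_eq_mk]
  refine Measurable.lintegral_prod_right' (f := fun z : EuclideanSpace ℝ (Fin N) ×
    EuclideanSpace ℝ (Fin N) => hh.mk h z.2 * rieszKernel μ (z.1 - z.2)) ?_
  exact (hh.measurable_mk.comp measurable_snd).mul
    ((measurable_rieszKernel μ).comp (measurable_fst.sub measurable_snd))

lemma aemeasurable_mul_rieszKernel (hh : AEMeasurable h volume) (x : EuclideanSpace ℝ (Fin N)) :
    AEMeasurable (fun y => h y * rieszKernel μ (x - y)) volume :=
  hh.mul ((measurable_rieszKernel μ).comp (measurable_const.sub measurable_id)).aemeasurable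

lemma rieszForm_eq_lintegral (hh : AEMeasurable h volume) :
    rieszForm μ f h = ∫⁻ x, f x * rieszPotential μ h x := by
  refine lintegral_congr fun x => ?_
  simp only [mul_assoc]
  exact lintegral_const_mul'' _ (aemeasurable_mul_rieszKernel hh x)

lemma rieszForm_add_left (hf : AEMeasurable f volume) (hh : AEMeasurable h volume) :
    rieszForm μ (fun x => f x + f' x) h = rieszForm μ f h + rieszForm μ f' h := by
  have hm : AEMeasurable (fun x => f x * rieszPotential μ h x) volume :=
    hf.mul (measurable_rieszPotential hh).aemeasurable
  rw [rieszForm_eq_lintegral hh, rieszForm_eq_lintegral hh, rieszForm_eq_lintegral hh,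
    ← lintegral_add_left' hm]
  simp only [add_mul]

lemma rieszForm_comm (hf : AEMeasurable f volume) (hh : AEMeasurable h volume) :
    rieszForm μ f h = rieszForm μ h f := by
  rw [rieszForm, lintegral_lintegral_swap]
  · refine lintegral_congr fun x => lintegral_congr fun y => ?_
    rw [mul_comm (f y), rieszKernel_sub_comm]
  · exact (hf.comp_fst.mul hh.comp_snd).mul
      ((measurable_rieszKernel μ).comp (measurable_fst.sub measurable_snd)).aemeasurable

lemma rieszForm_add_right (hf : AEMeasurable f volume) (hh : AEMeasurable h volume)
    (hh' : AEMeasurable h' volume) :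
    rieszForm μ f (fun x => h x + h' x) = rieszForm μ f h + rieszForm μ f h' := by
  have hm : AEMeasurable (fun x => h x + h' x) volume := hh.add hh'
  rw [rieszForm_comm hf hm, rieszForm_comm hf hh, rieszForm_comm hf hh',
    ← rieszForm_add_left hh hf]

lemma rieszForm_const_mul {c d : ENNReal} (hc : c ≠ ⊤) (hd : d ≠ ⊤) :
    rieszForm μ (fun x => c * f x) (fun x => d * h x) = c * d * rieszForm μ f h := by
  rw [rieszForm, rieszForm, ← lintegral_const_mul' _ _ (ENNReal.mul_ne_top hc hd)]
  refine lintegral_congr fun x => ?_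
  rw [← lintegral_const_mul' _ _ (ENNReal.mul_ne_top hc hd)]
  refine lintegral_congr fun y => ?_
  ring

lemma rieszForm_pos (hN : 0 < N) (hf : AEMeasurable f volume) (hh : AEMeasurable h volume)
    (hf0 : ¬ f =ᵐ[volume] 0) (hh0 : ¬ h =ᵐ[volume] 0) : 0 < rieszForm μ f h := by
  have : Nonempty (Fin N) := ⟨⟨0, hN⟩⟩
  have hm : AEMeasurable (fun x => f x * rieszPotential μ h x) volume :=
    hf.mul (measurable_rieszPotential hh).aemeasurable
  rw [pos_iff_ne_zero, rieszForm_eq_lintegral hh, Ne, lintegral_eq_zero_iff' hm]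
  intro h0
  refine hf0 ?_
  filter_upwards [h0] with x hx
  refine (mul_eq_zero.1 hx).resolve_right fun hpot => hh0 ?_
  rw [rieszPotential, lintegral_eq_zero_iff' (aemeasurable_mul_rieszKernel hh x)] at hpot
  filter_upwards [hpot, compl_mem_ae_iff.2 (measure_singleton x)] with y hy hyx
  exact (mul_eq_zero.1 hy).resolve_right (rieszKernel_pos (sub_ne_zero.2 (Ne.symm hyx))).ne'

lemma lintegral_rieszKernel_ball_lt_top (hN : 0 < N) (hμN : μ < N) :
    ∫⁻ z in Metric.ball (0 : EuclideanSpace ℝ (Fin N)) 1, rieszKernel μ z < ⊤ := by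
  have h := integrableOn_ball_of_norm_le_rpow (E := EuclideanSpace ℝ (Fin N)) (μ := volume)
    (f := fun z => (‖z‖ ^ μ)⁻¹) (C := 1) (α := μ) (r := 1)
    (by simpa using Nat.succ_le_of_lt hN) (by simpa using hμN)
    (ae_of_all _ fun z => by
      rw [Real.norm_of_nonneg (by positivity), one_mul, Real.rpow_neg (norm_nonneg z)])
    ((measurable_norm.pow_const μ).inv.aestronglyMeasurable)
  exact (hasFiniteIntegral_iff_ofReal (ae_of_all _ fun z => by positivity)).1 h.2

/-- The Riesz potential of a bounded integrable function is bounded: near `x` the kernel is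
integrable because `μ < N`, and at distance at least `1` it is at most `1`. -/
lemma rieszPotential_le (hμ : 0 ≤ μ) {M : ENNReal} (hM : ∀ y, h y ≤ M)
    (x : EuclideanSpace ℝ (Fin N)) :
    rieszPotential μ h x ≤
      M * (∫⁻ z in Metric.ball (0 : EuclideanSpace ℝ (Fin N)) 1, rieszKernel μ z) + ∫⁻ y, h y := by
  set B := Metric.ball (0 : EuclideanSpace ℝ (Fin N)) 1 with hB
  have hk : Measurable fun y => B.indicator (rieszKernel μ) (x - y) :=
    ((measurable_rieszKernel μ).indicator Metric.isOpen_ball.measurableSet).comp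
      (measurable_const.sub measurable_id)
  calc rieszPotential μ h x
      ≤ ∫⁻ y, (M * B.indicator (rieszKernel μ) (x - y) + h y) := by
        refine lintegral_mono fun y => ?_
        by_cases hy : x - y ∈ B
        · rw [Set.indicator_of_mem hy]
          exact le_add_right (by gcongr; exact hM y)
        · rw [Set.indicator_of_notMem hy, mul_zero, zero_add]
          refine mul_le_of_le_one_right' ?_
          rw [rieszKernel, ENNReal.ofReal_le_one]
          refine inv_le_one_of_one_le₀ (Real.one_le_rpow ?_ hμ)
          simpa [hB] using hy
    _ = M * (∫⁻ y, B.indicator (rieszKernel μ) (x - y)) + ∫⁻ y, h y := by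
        rw [lintegral_add_left (hk.const_mul _), lintegral_const_mul _ hk]
    _ = _ := by
        rw [lintegral_sub_left_eq_self (fun z => B.indicator (rieszKernel μ) z) x,
          lintegral_indicator Metric.isOpen_ball.measurableSet]

lemma rieszForm_lt_top (hN : 0 < N) (hμ : 0 ≤ μ) (hμN : μ < N) {M : ENNReal} (hM : M ≠ ⊤)
    (hh : AEMeasurable h volume) (hhM : ∀ y, h y ≤ M) (hhi : ∫⁻ y, h y ≠ ⊤)
    (hfi : ∫⁻ y, f y ≠ ⊤) : rieszForm μ f h < ⊤ := by
  rw [rieszForm_eq_lintegral hh]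
  refine (lintegral_mono fun x => mul_le_mul_right (rieszPotential_le hμ hhM x) (f x)).trans_lt ?_
  have : M * (∫⁻ z in Metric.ball (0 : EuclideanSpace ℝ (Fin N)) 1, rieszKernel μ z)
      + ∫⁻ y, h y ≠ ⊤ := ENNReal.add_ne_top.2
    ⟨ENNReal.mul_ne_top hM (lintegral_rieszKernel_ball_lt_top hN hμN).ne, hhi⟩
  rw [lintegral_mul_const' _ _ this]
  exact ENNReal.mul_lt_top hfi.lt_top this.lt_top

/-- Fatou's lemma for the Riesz form. -/
lemma rieszForm_le_liminf {F : ℕ → EuclideanSpace ℝ (Fin N) → ENNReal}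
    (hF : ∀ n, Measurable (F n)) (hfin : ∀ x, f x ≠ ⊤)
    (hlim : ∀ᵐ x ∂volume, Tendsto (fun n => F n x) atTop (𝓝 (f x))) :
    rieszForm μ f f ≤ liminf (fun n => rieszForm μ (F n) (F n)) atTop := by
  have hmeas : ∀ n x, Measurable fun y => F n x * F n y * rieszKernel μ (x - y) := fun n x =>
    ((hF n).const_mul _).mul ((measurable_rieszKernel μ).comp (measurable_const.sub measurable_id))
  calc rieszForm μ f f
      ≤ ∫⁻ x, ∫⁻ y, liminf (fun n => F n x * F n y * rieszKernel μ (x - y)) atTop := by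
        refine lintegral_mono_ae ?_
        filter_upwards [hlim] with x hx
        refine lintegral_mono_ae ?_
        filter_upwards [hlim] with y hy
        refine (Tendsto.liminf_eq ?_).ge
        exact ENNReal.Tendsto.mul_const (ENNReal.Tendsto.mul hx (Or.inr (hfin y)) hy
          (Or.inr (hfin x))) (Or.inr ENNReal.ofReal_ne_top)
    _ ≤ ∫⁻ x, liminf (fun n => ∫⁻ y, F n x * F n y * rieszKernel μ (x - y)) atTop :=
        lintegral_mono fun x => lintegral_liminf_le fun n => hmeas n x
    _ ≤ _ := by
        refine lintegral_liminf_le fun n => ?_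
        have : (fun x => ∫⁻ y, F n x * F n y * rieszKernel μ (x - y))
            = fun x => F n x * rieszPotential μ (F n) x := by
          ext1 x
          simp only [mul_assoc]
          exact lintegral_const_mul'' _ (aemeasurable_mul_rieszKernel (hF n).aemeasurable x)
        rw [this]
        exact (hF n).mul (measurable_rieszPotential (hF n).aemeasurable)

/-- Change of variables under the dilation `x ↦ σ (x - a)`. -/
lemma lintegral_comp_dilation {σ : ℝ} (hσ : 0 < σ) (a : EuclideanSpace ℝ (Fin N))
    (f : EuclideanSpace ℝ (Fin N) → ENNReal) :
    ∫⁻ x, f (σ • (x - a)) = ENNReal.ofReal (σ ^ N)⁻¹ * ∫⁻ x, f x := by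
  rw [lintegral_sub_right_eq_self (fun x => f (σ • x)) a]
  have h := (Homeomorph.smulOfNeZero σ hσ.ne').measurableEmbedding.lintegral_map
    (μ := (volume : Measure (EuclideanSpace ℝ (Fin N)))) f
  simp only [Homeomorph.smulOfNeZero_apply] at h
  rw [← h]
  have h2 := Measure.map_addHaar_smul (volume : Measure (EuclideanSpace ℝ (Fin N))) hσ.ne'
  change ∫⁻ x, f x ∂(Measure.map (fun x => σ • x) volume) = _
  rw [h2, lintegral_smul_measure, smul_eq_mul, finrank_euclideanSpace_fin,
    abs_of_pos (by positivity)]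

lemma rieszKernel_smul {σ : ℝ} (hσ : 0 < σ) (z : EuclideanSpace ℝ (Fin N)) :
    rieszKernel μ z = ENNReal.ofReal (σ ^ μ) * rieszKernel μ (σ • z) := by
  rw [rieszKernel, rieszKernel, ← ENNReal.ofReal_mul (by positivity), norm_smul,
    Real.norm_of_nonneg hσ.le, Real.mul_rpow hσ.le (norm_nonneg z), mul_inv, ← mul_assoc,
    mul_inv_cancel₀ (by positivity), one_mul]

lemma rieszForm_comp_dilation {σ : ℝ} (hσ : 0 < σ) (a : EuclideanSpace ℝ (Fin N)) :
    rieszForm μ (fun x => f (σ • (x - a))) (fun x => h (σ • (x - a)))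
      = ENNReal.ofReal (σ ^ μ * ((σ ^ N)⁻¹) ^ 2) * rieszForm μ f h := by
  have e1 : ∀ x y : EuclideanSpace ℝ (Fin N), rieszKernel μ (x - y)
      = ENNReal.ofReal (σ ^ μ) * rieszKernel μ (σ • (x - a) - σ • (y - a)) := fun x y => by
    rw [rieszKernel_smul hσ, ← smul_sub, sub_sub_sub_cancel_right]
  have e2 : ∀ x : EuclideanSpace ℝ (Fin N),
      ∫⁻ y, f (σ • (x - a)) * h (σ • (y - a)) * rieszKernel μ (x - y)
      = ENNReal.ofReal (σ ^ μ) * (ENNReal.ofReal (σ ^ N)⁻¹ *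
        ∫⁻ y, f (σ • (x - a)) * h y * rieszKernel μ (σ • (x - a) - y)) := fun x => by
    rw [← lintegral_comp_dilation hσ a
      (fun y => f (σ • (x - a)) * h y * rieszKernel μ (σ • (x - a) - y)),
      ← lintegral_const_mul' _ _ ENNReal.ofReal_ne_top]
    refine lintegral_congr fun y => ?_
    rw [e1 x y]
    ring
  rw [rieszForm, lintegral_congr e2, lintegral_const_mul' _ _ ENNReal.ofReal_ne_top,
    lintegral_const_mul' _ _ ENNReal.ofReal_ne_top,
    lintegral_comp_dilation hσ a (fun x => ∫⁻ y, f x * h y * rieszKernel μ (x - y)),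
    ENNReal.ofReal_mul (by positivity), sq, ENNReal.ofReal_mul (by positivity), rieszForm]
  ring

end RieszForm

/-! ### The nonlocal energy -/

lemma one_lt_critExp (hN : 3 < N) {μ : ℝ} (hμN : μ < N) : 1 < critExp N μ := by
  have h3 : (3 : ℝ) < N := by exact_mod_cast hN
  rw [critExp, one_lt_div (by linarith)]
  linarith

lemma ofReal_critExp_le_sobolevExp (hN : 3 < N) {μ : ℝ} (hμ : 0 ≤ μ) :
    ENNReal.ofReal (critExp N μ) ≤ sobolevExp N := by
  have h3 : (3 : ℝ) < N := by exact_mod_cast hN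
  refine ENNReal.ofReal_le_ofReal ?_
  rw [critExp]
  gcongr
  · linarith
  · linarith

/-- The function `(u⁺)^p` with values in `[0, ∞]`. -/
noncomputable def posPow (p : ℝ) (u : EuclideanSpace ℝ (Fin N) → ℝ)
    (x : EuclideanSpace ℝ (Fin N)) : ENNReal :=
  ENNReal.ofReal (max (u x) 0 ^ p)

/-- The double integral over the whole space, as an element of `[0, ∞]`. -/
noncomputable def doubleLint (μ : ℝ) (u : EuclideanSpace ℝ (Fin N) → ℝ) : ENNReal :=
  rieszForm μ (posPow (critExp N μ) u) (posPow (critExp N μ) u)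

section

variable {p μ : ℝ} {u v : EuclideanSpace ℝ (Fin N) → ℝ} {Ω : Set (EuclideanSpace ℝ (Fin N))}

lemma aemeasurable_posPow (hu : AEMeasurable u volume) : AEMeasurable (posPow p u) volume :=
  ((hu.max aemeasurable_const).pow_const p).ennreal_ofReal

lemma continuous_posPow (hp : 0 ≤ p) (hu : Continuous u) : Continuous (posPow p u) :=
  ENNReal.continuous_ofReal.comp
    ((hu.max continuous_const).rpow_const fun _ => Or.inr hp)

lemma posPow_mono (hp : 0 ≤ p) {x : EuclideanSpace ℝ (Fin N)} (h : u x ≤ v x) :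
    posPow p u x ≤ posPow p v x := by
  refine ENNReal.ofReal_le_ofReal (Real.rpow_le_rpow (le_max_right _ _) ?_ hp)
  exact max_le_max_right 0 h

lemma posPow_eq_zero (hp : p ≠ 0) {x : EuclideanSpace ℝ (Fin N)} (h : u x ≤ 0) :
    posPow p u x = 0 := by
  rw [posPow, max_eq_right h, Real.zero_rpow hp, ENNReal.ofReal_zero]

lemma posPow_const_mul {c : ℝ} (hc : 0 ≤ c) :
    posPow p (fun x => c * u x) = fun x => ENNReal.ofReal (c ^ p) * posPow p u x := by
  ext1 x
  rw [posPow, posPow, ← ENNReal.ofReal_mul (Real.rpow_nonneg hc _),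
    ← Real.mul_rpow hc (le_max_right _ _), mul_max_of_nonneg _ _ hc, mul_zero]

lemma doubleInt_eq (hp : critExp N μ ≠ 0) (hΩ : MeasurableSet Ω) :
    doubleInt μ Ω u = (doubleLint μ (Ω.indicator u)).toReal := by
  rw [doubleInt, doubleLint, rieszForm]
  congr 1
  have e : ∀ x y, ENNReal.ofReal
      (max (u x) 0 ^ critExp N μ * max (u y) 0 ^ critExp N μ / ‖x - y‖ ^ μ)
      = posPow (critExp N μ) u x * posPow (critExp N μ) u y * rieszKernel μ (x - y) := by
    intro x y
    rw [posPow, posPow, rieszKernel, div_eq_mul_inv, ENNReal.ofReal_mul (by positivity),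
      ENNReal.ofReal_mul (by positivity)]
  have e0 : ∀ x ∉ Ω, posPow (critExp N μ) (Ω.indicator u) x = 0 := fun x hx =>
    posPow_eq_zero hp (by simp [hx])
  have e1 : ∀ x ∈ Ω, posPow (critExp N μ) (Ω.indicator u) x = posPow (critExp N μ) u x :=
    fun x hx => by simp only [posPow, Set.indicator_of_mem hx]
  simp only [e]
  rw [← lintegral_indicator hΩ]
  refine lintegral_congr fun x => ?_
  by_cases hx : x ∈ Ω
  · rw [Set.indicator_of_mem hx, ← lintegral_indicator hΩ]
    refine lintegral_congr fun y => ?_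
    by_cases hy : y ∈ Ω
    · rw [Set.indicator_of_mem hy, e1 x hx, e1 y hy]
    · simp [hy, e0 y hy]
  · simp [hx, e0 x hx]

lemma doubleInt_univ (hp : critExp N μ ≠ 0) :
    doubleInt μ Set.univ u = (doubleLint μ u).toReal := by
  rw [doubleInt_eq hp MeasurableSet.univ, Set.indicator_univ]

lemma doubleInt_univ_indicator (hp : critExp N μ ≠ 0) (hΩ : MeasurableSet Ω) :
    doubleInt μ Set.univ (Ω.indicator u) = doubleInt μ Ω u := by
  rw [doubleInt_eq hp hΩ, doubleInt_univ hp]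

lemma doubleInt_nonneg : 0 ≤ doubleInt μ Ω u := ENNReal.toReal_nonneg

lemma doubleLint_const_mul {c : ℝ} (hc : 0 ≤ c) :
    doubleLint μ (fun x => c * u x) = ENNReal.ofReal ((c ^ critExp N μ) ^ 2) * doubleLint μ u := by
  rw [doubleLint, posPow_const_mul hc,
    rieszForm_const_mul ENNReal.ofReal_ne_top ENNReal.ofReal_ne_top, sq,
    ENNReal.ofReal_mul (by positivity), doubleLint]

lemma doubleInt_const_mul (hp : critExp N μ ≠ 0) (hΩ : MeasurableSet Ω) {c : ℝ} (hc : 0 ≤ c) :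
    doubleInt μ Ω (fun x => c * u x) = (c ^ critExp N μ) ^ 2 * doubleInt μ Ω u := by
  have : Ω.indicator (fun x => c * u x) = fun x => c * Ω.indicator u x := by
    ext1 x
    by_cases hx : x ∈ Ω <;> simp [hx]
  rw [doubleInt_eq hp hΩ, doubleInt_eq hp hΩ, this, doubleLint_const_mul hc, ENNReal.toReal_mul,
    ENNReal.toReal_ofReal (by positivity)]

lemma doubleInt_eq_zero_of_ae (hp : critExp N μ ≠ 0) (hu : u =ᵐ[volume.restrict Ω] 0) :
    doubleInt μ Ω u = 0 := by
  rw [doubleInt, lintegral_congr_ae (g := 0), lintegral_zero_fun, ENNReal.toReal_zero]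
  filter_upwards [hu] with x hx
  simp [hx, Real.zero_rpow hp]

lemma doubleInt_comp_dilation (hp : critExp N μ ≠ 0) {σ : ℝ} (hσ : 0 < σ)
    (a : EuclideanSpace ℝ (Fin N)) :
    doubleInt μ Set.univ (fun x => u (σ • (x - a)))
      = σ ^ μ * ((σ ^ N)⁻¹) ^ 2 * doubleInt μ Set.univ u := by
  have h := rieszForm_comp_dilation (μ := μ) (f := posPow (critExp N μ) u)
    (h := posPow (critExp N μ) u) hσ a
  rw [doubleInt_univ hp, doubleInt_univ hp, doubleLint]
  change (rieszForm μ (fun x => posPow (critExp N μ) u (σ • (x - a)))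
    (fun x => posPow (critExp N μ) u (σ • (x - a)))).toReal = _
  rw [h, ENNReal.toReal_mul, ENNReal.toReal_ofReal (by positivity), doubleLint]

lemma IsTest.exists_posPow_le (hp : 0 < p) (hu : IsTest Ω u) :
    ∃ M : ENNReal, M ≠ ⊤ ∧ ∀ x, posPow p u x ≤ M := by
  obtain ⟨C, hC⟩ := hu.continuous.bounded_above_of_compact_support hu.2.1
  refine ⟨ENNReal.ofReal (C ^ p), ENNReal.ofReal_ne_top, fun x => ?_⟩
  refine ENNReal.ofReal_le_ofReal (Real.rpow_le_rpow (le_max_right _ _) ?_ hp.le)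
  exact max_le ((le_abs_self _).trans (hC x)) ((norm_nonneg _).trans (hC x))

lemma posPow_le_enorm_rpow (hp : 0 ≤ p) (x : EuclideanSpace ℝ (Fin N)) :
    posPow p u x ≤ ‖u x‖ₑ ^ p := by
  rw [posPow, ← ofReal_norm, ENNReal.ofReal_rpow_of_nonneg (norm_nonneg _) hp]
  refine ENNReal.ofReal_le_ofReal (Real.rpow_le_rpow (le_max_right _ _) ?_ hp)
  exact max_le (le_abs_self _) (norm_nonneg _)

lemma lintegral_posPow_ne_top (hp : 0 < p) (hu : MemLp u (ENNReal.ofReal p) (volume.restrict Ω))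
    (hΩ : MeasurableSet Ω) (h0 : ∀ x ∉ Ω, u x = 0) : ∫⁻ x, posPow p u x ≠ ⊤ := by
  have h1 : ∫⁻ x in Ω, ‖u x‖ₑ ^ p < ⊤ := by
    have := lintegral_rpow_enorm_lt_top_of_eLpNorm_lt_top (by simpa using hp)
      ENNReal.ofReal_ne_top hu.2
    rwa [ENNReal.toReal_ofReal hp.le] at this
  refine (lt_of_le_of_lt ?_ h1).ne
  rw [← lintegral_indicator hΩ]
  refine lintegral_mono fun x => ?_
  by_cases hx : x ∈ Ω
  · rw [Set.indicator_of_mem hx]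
    exact posPow_le_enorm_rpow hp.le x
  · rw [posPow_eq_zero hp.ne' (h0 x hx).le]
    exact zero_le

lemma IsTest.lintegral_posPow_ne_top (hp : 0 < p) (hu : IsTest Ω u) :
    ∫⁻ x, posPow p u x ≠ ⊤ :=
  Choquard.lintegral_posPow_ne_top hp ((hu.memLp _).restrict Set.univ) MeasurableSet.univ (by simp)

lemma IsTest.doubleLint_lt_top (hN : 3 < N) (hμ : 0 ≤ μ) (hμN : μ < N) (hu : IsTest Ω u) :
    doubleLint μ u < ⊤ := by
  have hp : 0 < critExp N μ := one_pos.trans (one_lt_critExp hN hμN)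
  obtain ⟨M, hM, hle⟩ := hu.exists_posPow_le hp
  exact rieszForm_lt_top (by omega) hμ hμN hM
    (aemeasurable_posPow hu.continuous.measurable.aemeasurable) hle
    (hu.lintegral_posPow_ne_top hp) (hu.lintegral_posPow_ne_top hp)

lemma IsTest.doubleInt_pos (hN : 3 < N) (hμ : 0 ≤ μ) (hμN : μ < N) (hu : IsTest Ω u)
    {a : EuclideanSpace ℝ (Fin N)} (ha : 0 < u a) : 0 < doubleInt μ Set.univ u := by
  have hp : 0 < critExp N μ := one_pos.trans (one_lt_critExp hN hμN)
  have hm : AEMeasurable (posPow (critExp N μ) u) volume :=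
    aemeasurable_posPow hu.continuous.measurable.aemeasurable
  have hne : ¬ posPow (critExp N μ) u =ᵐ[volume] 0 := fun h0 => by
    rw [(continuous_posPow hp.le hu.continuous).ae_eq_iff_eq volume continuous_zero] at h0
    have h1 := congrFun h0 a
    rw [posPow, max_eq_left ha.le] at h1
    exact (ENNReal.ofReal_pos.2 (Real.rpow_pos_of_pos ha _)).ne' h1
  rw [doubleInt_univ hp.ne']
  exact ENNReal.toReal_pos (rieszForm_pos (by omega) hm hm hne hne).ne'
    (hu.doubleLint_lt_top hN hμ hμN).ne

/-- Bernoulli's inequality for the positive part, for a perturbation that equals `t` where `u` is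
positive. -/
lemma posPow_add_ge (hp : 1 < p) {t : ℝ} (ht : 0 ≤ t) {φ : EuclideanSpace ℝ (Fin N) → ℝ}
    (h1 : ∀ x, 0 < u x → φ x = 1) (x : EuclideanSpace ℝ (Fin N)) :
    posPow p u x + ENNReal.ofReal t * (ENNReal.ofReal p * posPow (p - 1) u x)
      ≤ posPow p (fun x => u x + t * φ x) x := by
  rcases le_or_gt (u x) 0 with hx | hx
  · rw [posPow_eq_zero (by linarith) hx, posPow_eq_zero (by linarith) hx]
    simp
  · simp only [posPow, h1 x hx, mul_one]
    rw [max_eq_left hx.le, max_eq_left (by linarith), ← ENNReal.ofReal_mul (by linarith),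
      ← ENNReal.ofReal_mul ht, ← ENNReal.ofReal_add (by positivity) (by positivity)]
    refine ENNReal.ofReal_le_ofReal ?_
    have hb := one_add_mul_self_le_rpow_one_add (s := t / u x)
      (by linarith [div_nonneg ht hx.le]) hp.le
    have e : u x + t = u x * (1 + t / u x) := by field_simp
    rw [e, Real.mul_rpow hx.le (by positivity)]
    refine le_trans (le_of_eq ?_) (mul_le_mul_of_nonneg_left hb (by positivity))
    rw [Real.rpow_sub_one hx.ne']
    field_simp

lemma posPow_add_le (hp : 0 ≤ p) {φ : EuclideanSpace ℝ (Fin N) → ℝ} (hφ : ∀ x, 0 ≤ φ x)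
    (x : EuclideanSpace ℝ (Fin N)) :
    posPow p (fun x => u x + φ x) x
      ≤ ENNReal.ofReal (2 ^ p) * (posPow p u x + posPow p φ x) := by
  simp only [posPow]
  rw [← ENNReal.ofReal_add (by positivity) (by positivity), ← ENNReal.ofReal_mul (by positivity)]
  refine ENNReal.ofReal_le_ofReal ?_
  rw [max_eq_left (hφ x)]
  set a := max (u x) 0
  have ha : 0 ≤ a := le_max_right _ _
  have h1 : max (u x + φ x) 0 ≤ 2 * max a (φ x) := by
    have := le_max_left (u x) 0
    have := le_max_left a (φ x)
    have := le_max_right a (φ x)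
    exact max_le (by linarith) (by linarith)
  calc max (u x + φ x) 0 ^ p ≤ (2 * max a (φ x)) ^ p :=
        Real.rpow_le_rpow (le_max_right _ _) h1 hp
    _ = 2 ^ p * max a (φ x) ^ p := Real.mul_rpow (by norm_num) (ha.trans (le_max_left _ _))
    _ ≤ _ := by
        gcongr
        have h2 := Real.rpow_nonneg ha p
        have h3 := Real.rpow_nonneg (hφ x) p
        rcases le_total a (φ x) with h | h
        · rw [max_eq_right h]; linarith
        · rw [max_eq_left h]; linarith

/-- Raising a compactly supported function with finite nonlocal energy by `t` on its support raises
the nonlocal energy by at least a positive multiple of `t`. -/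
lemma exists_doubleInt_add_ge (hN : 3 < N) (hμ : 0 ≤ μ) (hμN : μ < N) (hΩ : MeasurableSet Ω)
    (hΩfin : volume Ω ≠ ⊤) (hu : MemLp u (sobolevExp N) volume) (hu0 : ∀ x ∉ Ω, u x = 0)
    (hfin : doubleLint μ u ≠ ⊤) (hpos : 0 < doubleInt μ Set.univ u)
    {φ : EuclideanSpace ℝ (Fin N) → ℝ} (hφt : IsTest Set.univ φ)
    (hφ : ∀ x, 0 ≤ φ x) (h1 : ∀ x ∈ Ω, φ x = 1) :
    ∃ c : ℝ, 0 < c ∧ ∀ t : ℝ, 0 < t → t ≤ 1 →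
      doubleInt μ Set.univ u + c * t ≤ doubleInt μ Set.univ (fun x => u x + t * φ x) := by
  have hp1 := one_lt_critExp hN hμN
  have hple := ofReal_critExp_le_sobolevExp hN hμ
  have hp : critExp N μ ≠ 0 := by linarith
  rw [doubleInt_univ hp] at hpos ⊢
  set p := critExp N μ with hpdef
  have hp0 : 0 < p := by linarith
  set F := posPow p u with hF
  set Φ := posPow p φ with hΦ
  set H : EuclideanSpace ℝ (Fin N) → ENNReal := fun x => ENNReal.ofReal p * posPow (p - 1) u x
  have h1' : ∀ x, 0 < u x → φ x = 1 := fun x hx => h1 x (by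
    by_contra hxΩ
    exact hx.ne' (hu0 x hxΩ))
  have mu : AEMeasurable u volume := hu.1.aemeasurable
  have mF : AEMeasurable F volume := aemeasurable_posPow mu
  have mH : AEMeasurable H volume := (aemeasurable_posPow mu).const_mul _
  have mΦ : AEMeasurable Φ volume := aemeasurable_posPow hφt.continuous.measurable.aemeasurable
  -- all competitors lie below `u + φ`, whose energy is finite since `F` is integrable and `φ` is
  -- a test function
  have hFi : ∫⁻ x, F x ≠ ⊤ := by
    have : IsFiniteMeasure (volume.restrict Ω) := ⟨by simpa using hΩfin.lt_top⟩
    exact lintegral_posPow_ne_top hp0 ((hu.restrict Ω).mono_exponent hple) hΩ hu0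
  have hfin1 : doubleLint μ (fun x => u x + 1 * φ x) < ⊤ := by
    obtain ⟨M, hM, hMle⟩ := hφt.exists_posPow_le hp0
    have hΦi := hφt.lintegral_posPow_ne_top hp0
    have hFΦ : rieszForm μ F Φ < ⊤ :=
      rieszForm_lt_top (by omega) hμ hμN hM mΦ hMle hΦi hFi
    have hΦΦ : rieszForm μ Φ Φ < ⊤ :=
      rieszForm_lt_top (by omega) hμ hμN hM mΦ hMle hΦi hΦi
    have mS : AEMeasurable (fun x => F x + Φ x) volume := mF.add mΦ
    have hle : doubleLint μ (fun x => u x + 1 * φ x) ≤ _ := rieszForm_mono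
      (fun x => posPow_add_le hp0.le (u := u) (φ := fun x => 1 * φ x) (by simpa using hφ) x)
      (fun x => posPow_add_le hp0.le (u := u) (φ := fun x => 1 * φ x) (by simpa using hφ) x)
    simp only [one_mul] at hle ⊢
    refine hle.trans_lt ?_
    rw [rieszForm_const_mul ENNReal.ofReal_ne_top ENNReal.ofReal_ne_top,
      rieszForm_add_left mF mS, rieszForm_add_right mF mF mΦ, rieszForm_add_right mΦ mF mΦ,
      rieszForm_comm mΦ mF]
    exact ENNReal.mul_lt_top (ENNReal.mul_lt_top ENNReal.ofReal_lt_top ENNReal.ofReal_lt_top)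
      (ENNReal.add_lt_top.2 ⟨ENNReal.add_lt_top.2 ⟨hfin.lt_top, hFΦ⟩,
        ENNReal.add_lt_top.2 ⟨hFΦ, hΦΦ⟩⟩)
  have hge : ∀ t : ℝ, 0 ≤ t → doubleLint μ u + ENNReal.ofReal t * rieszForm μ F H
      ≤ doubleLint μ (fun x => u x + t * φ x) := fun t ht => by
    have hb := posPow_add_ge hp1 ht h1'
    have mtH : AEMeasurable (fun x => ENNReal.ofReal t * H x) volume := mH.const_mul _
    calc doubleLint μ u + ENNReal.ofReal t * rieszForm μ F H
        = rieszForm μ F (fun x => F x + ENNReal.ofReal t * H x) := by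
          rw [rieszForm_add_right mF mF mtH, doubleLint]
          congr 1
          have := rieszForm_const_mul (μ := μ) (f := F) (h := H) ENNReal.one_ne_top
            (ENNReal.ofReal_ne_top (r := t))
          simpa using this.symm
      _ ≤ _ := rieszForm_mono (fun x => le_self_add.trans (hb x)) hb
  have hFH : rieszForm μ F H < ⊤ := by
    refine lt_of_le_of_lt ?_ ((hge 1 zero_le_one).trans_lt hfin1)
    simp
  have hF0 : ¬ F =ᵐ[volume] 0 := fun h0 => hpos.ne' (by
    rw [doubleLint, ← hpdef, ← hF, rieszForm, lintegral_congr_ae (g := 0)]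
    · simp
    · filter_upwards [h0] with x hx
      simp [hx])
  have hH0 : ¬ H =ᵐ[volume] 0 := fun h0 => hF0 (by
    filter_upwards [h0] with x hx
    have h2 : posPow (p - 1) u x = 0 :=
      (mul_eq_zero.1 hx).resolve_left (ENNReal.ofReal_pos.2 hp0).ne'
    rcases le_or_gt (u x) 0 with hux | hux
    · exact posPow_eq_zero hp0.ne' hux
    · rw [posPow, max_eq_left hux.le, ENNReal.ofReal_eq_zero] at h2
      exact absurd h2 (not_le.2 (Real.rpow_pos_of_pos hux _)))
  refine ⟨(rieszForm μ F H).toReal,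
    ENNReal.toReal_pos (rieszForm_pos (by omega) mF mH hF0 hH0).ne' hFH.ne, fun t ht ht1 => ?_⟩
  have hmono : doubleLint μ (fun x => u x + t * φ x) ≤ doubleLint μ (fun x => u x + 1 * φ x) := by
    have : ∀ x, posPow p (fun x => u x + t * φ x) x ≤ posPow p (fun x => u x + 1 * φ x) x :=
      fun x => posPow_mono hp0.le (by have := hφ x; gcongr)
    exact rieszForm_mono this this
  rw [doubleInt_univ hp]
  have h3 := ENNReal.toReal_mono (hmono.trans_lt hfin1).ne (hge t ht.le)
  rwa [ENNReal.toReal_add hfin (ENNReal.mul_lt_top ENNReal.ofReal_lt_top hFH).ne,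
    ENNReal.toReal_mul, ENNReal.toReal_ofReal ht.le, mul_comm t] at h3

/-- Lower semicontinuity of the nonlocal energy along almost everywhere convergent sequences. -/
lemma doubleLint_le_liminf (hp : 0 ≤ critExp N μ) {φ : ℕ → EuclideanSpace ℝ (Fin N) → ℝ}
    (hφ : ∀ n, Continuous (φ n))
    (hlim : ∀ᵐ x ∂volume, Tendsto (fun n => φ n x) atTop (𝓝 (u x))) :
    doubleLint μ u ≤ liminf (fun n => doubleLint μ (φ n)) atTop := by
  refine rieszForm_le_liminf (fun n => (continuous_posPow hp (hφ n)).measurable)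
    (fun x => ENNReal.ofReal_ne_top) ?_
  filter_upwards [hlim] with x hx
  exact ENNReal.tendsto_ofReal ((hx.max tendsto_const_nhds).rpow_const (Or.inr hp))

end

/-! ### Projection to the Nehari manifold -/

/-- The energy of the multiple of `u` lying on the Nehari manifold, when `u` has quadratic part `Q`
and nonlocal part `B`. -/
noncomputable def projLevel (p Q B : ℝ) : ℝ :=
  (1 / 2 - 1 / (2 * p)) * ((Q / B) ^ (1 / (p - 1)) * Q)

section projLevel

variable {p : ℝ}

lemma half_sub_pos (hp : 1 < p) : 0 < 1 / 2 - 1 / (2 * p) := by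
  have : 1 / (2 * p) < 1 / 2 := by
    apply one_div_lt_one_div_of_lt <;> linarith
  linarith

lemma exists_scaling (hp : 1 < p) {Q B : ℝ} (hQ : 0 < Q) (hB : 0 < B) :
    ∃ s : ℝ, 0 < s ∧ s ^ 2 * Q = (s ^ p) ^ 2 * B ∧
      1 / 2 * (s ^ 2 * Q) - 1 / (2 * p) * ((s ^ p) ^ 2 * B) = projLevel p Q B := by
  have hp0 : p - 1 ≠ 0 := by linarith
  have hQB : 0 < Q / B := div_pos hQ hB
  set s := (Q / B) ^ (1 / (2 * (p - 1))) with hs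
  have hs0 : 0 < s := Real.rpow_pos_of_pos hQB _
  have h1 : s ^ 2 = (Q / B) ^ (1 / (p - 1)) := by
    rw [hs, ← Real.rpow_natCast, ← Real.rpow_mul hQB.le]
    congr 1
    push_cast
    field_simp
  have h2 : (s ^ p) ^ 2 = s ^ 2 * (Q / B) := by
    rw [h1, hs, ← Real.rpow_mul hQB.le, ← Real.rpow_natCast, ← Real.rpow_mul hQB.le]
    conv_rhs => rw [← Real.rpow_add_one hQB.ne']
    congr 1
    push_cast
    field_simp
    ring
  have h3 : s ^ 2 * Q = (s ^ p) ^ 2 * B := by rw [h2]; field_simp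
  refine ⟨s, hs0, h3, ?_⟩
  rw [← h3, projLevel, ← h1]
  ring

lemma projLevel_mono (hp : 1 < p) {Q Q' B B' : ℝ} (hQ : 0 ≤ Q) (hQQ : Q ≤ Q') (hB : 0 < B)
    (hBB : B ≤ B') : projLevel p Q B' ≤ projLevel p Q' B := by
  have h1 := (half_sub_pos hp).le
  have h2 : 0 ≤ 1 / (p - 1) := by
    have : 0 < p - 1 := by linarith
    positivity
  have h3 : Q / B' ≤ Q' / B := div_le_div₀ (hQ.trans hQQ) hQQ hB hBB
  have h4 : 0 ≤ Q / B' := div_nonneg hQ (hB.le.trans hBB)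
  have h5 : 0 ≤ Q' / B := h4.trans h3
  rw [projLevel, projLevel]
  gcongr

lemma projLevel_self {B : ℝ} (hB : B ≠ 0) :
    projLevel p B B = (1 / 2 - 1 / (2 * p)) * B := by
  rw [projLevel, div_self hB, Real.one_rpow, one_mul]

lemma tendsto_projLevel (hp : 1 < p) {α : Type*} {l : Filter α} {f k : α → ℝ} {Q B : ℝ}
    (hB : B ≠ 0) (hf : Tendsto f l (𝓝 Q)) (hk : Tendsto k l (𝓝 B)) :
    Tendsto (fun t => projLevel p (f t) (k t)) l (𝓝 (projLevel p Q B)) := by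
  have h2 : 0 ≤ 1 / (p - 1) := by
    have : 0 < p - 1 := by linarith
    positivity
  exact (((hf.div hk hB).rpow_const (Or.inr h2)).mul hf).const_mul _

lemma projLevel_scale (hp : 1 < p) {a Q B : ℝ} (ha : 0 < a) (hQ : 0 ≤ Q) (hB : 0 ≤ B) :
    projLevel p (a * Q) (a ^ p * B) = projLevel p Q B := by
  have hp0 : p - 1 ≠ 0 := by linarith
  have e : a * Q / (a ^ p * B) = a ^ (1 - p) * (Q / B) := by
    rw [Real.rpow_sub ha, Real.rpow_one]
    field_simp
  have e2 : (a ^ (1 - p)) ^ (1 / (p - 1)) = a⁻¹ := by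
    rw [← Real.rpow_mul ha.le, ← Real.rpow_neg_one]
    congr 1
    field_simp
    ring
  rw [projLevel, projLevel, e, Real.mul_rpow (by positivity) (by positivity), e2]
  field_simp

/-- A quadratic increase of the quadratic part is outweighed by a linear increase of the nonlocal
part. -/
lemma exists_projLevel_lt (hp : 1 < p) {B C c : ℝ} (hB : 0 < B) (hC : 0 ≤ C) (hc : 0 < c) :
    ∃ t : ℝ, 0 < t ∧ t ≤ 1 ∧ projLevel p (B + t ^ 2 * C) (B + c * t) < projLevel p B B := by
  by_contra! hcon
  have hp0 : 0 < p - 1 := by linarith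
  -- otherwise the function `(B + t²C)^p`, whose derivative at `0` vanishes, grows linearly
  have key : ∀ t : ℝ, 0 < t → t ≤ 1 → B ^ (p - 1) * c ≤ t⁻¹ • ((B + (0 + t) ^ 2 * C) ^ p
      - (B + 0 ^ 2 * C) ^ p) := by
    intro t ht ht1
    have h := hcon t ht ht1
    rw [projLevel_self hB.ne', projLevel, mul_le_mul_iff_right₀ (half_sub_pos hp)] at h
    have hQ : 0 < B + t ^ 2 * C := by positivity
    have hR : 0 < B + c * t := by positivity
    have h1 := Real.rpow_le_rpow hB.le h hp0.le
    rw [Real.mul_rpow (by positivity) hQ.le, ← Real.rpow_mul (by positivity),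
      one_div_mul_cancel hp0.ne', Real.rpow_one, div_mul_eq_mul_div, le_div_iff₀ hR,
      Real.rpow_sub_one hQ.ne', mul_div_cancel₀ _ hQ.ne'] at h1
    have e : B ^ p = B ^ (p - 1) * B := by
      rw [Real.rpow_sub_one hB.ne']
      field_simp
    rw [smul_eq_mul, ← div_eq_inv_mul, le_div_iff₀ ht]
    simp only [zero_add, ne_eq, OfNat.ofNat_ne_zero, not_false_eq_true, zero_pow, zero_mul,
      add_zero]
    rw [e]
    linarith
  have hd : HasDerivAt (fun t : ℝ => (B + t ^ 2 * C) ^ p) 0 0 := by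
    have h1 : HasDerivAt (fun t : ℝ => B + t ^ 2 * C) 0 0 := by
      simpa using ((hasDerivAt_pow 2 (0 : ℝ)).mul_const C).const_add B
    simpa using h1.rpow_const (p := p) (Or.inr hp.le)
  have hlim := hd.tendsto_slope_zero_right
  have hle : B ^ (p - 1) * c ≤ 0 := by
    refine ge_of_tendsto hlim ?_
    filter_upwards [Ioc_mem_nhdsGT zero_lt_one] with t ht using key t ht.1 ht.2
  exact absurd hle (not_le.2 (by positivity))

end projLevel

section Nehari

variable {μ lam : ℝ} {Ω : Set (EuclideanSpace ℝ (Fin N))} {u v : EuclideanSpace ℝ (Fin N) → ℝ}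
  {g : EuclideanSpace ℝ (Fin N) → EuclideanSpace ℝ (Fin N)}

lemma HasWeakGradient.dirichlet_const_mul (hΩ : IsOpen Ω) (h : HasWeakGradient Ω u g) (c : ℝ) :
    dirichlet Ω (fun x => c * u x) = c ^ 2 * dirichlet Ω u := by
  rw [(h.const_mul c).dirichlet_eq hΩ, h.dirichlet_eq hΩ, ← integral_const_mul]
  refine integral_congr_ae (ae_of_all _ fun x => ?_)
  simp [norm_smul, mul_pow]

lemma not_ae_zero_const_mul {s : ℝ} (hs : 0 < s) {ν : Measure (EuclideanSpace ℝ (Fin N))}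
    (hu : ¬ u =ᵐ[ν] 0) : ¬ (fun x => s * u x) =ᵐ[ν] 0 := fun h0 => hu (by
  filter_upwards [h0] with x hx
  exact (mul_eq_zero.1 hx).resolve_left hs.ne')

lemma exists_nehari_energy_eq (hN : 3 < N) (hμN : μ < N)
    (h : ClosureTestWith (sobolevExp N) Set.univ u g) (hB : 0 < doubleInt μ Set.univ u) :
    ∃ w ∈ nehari N μ, energy μ w
      = projLevel (critExp N μ) (dirichlet Set.univ u) (doubleInt μ Set.univ u) := by
  have hp := one_lt_critExp hN hμN
  have hp0 : critExp N μ ≠ 0 := by linarith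
  have hu : ¬ u =ᵐ[volume] 0 := fun h0 =>
    hB.ne' (doubleInt_eq_zero_of_ae hp0 (by rwa [Measure.restrict_univ]))
  obtain ⟨s, hs, h1, h2⟩ := exists_scaling hp (h.dirichlet_pos hN hu) hB
  refine ⟨fun x => s * u x, ⟨memClosureTest_iff.2 ⟨_, h.const_mul s⟩,
    not_ae_zero_const_mul hs hu, ?_⟩, ?_⟩
  · rw [h.hasWeakGradient.dirichlet_const_mul isOpen_univ,
      doubleInt_const_mul hp0 MeasurableSet.univ hs.le, h1]
  · rw [energy, h.hasWeakGradient.dirichlet_const_mul isOpen_univ,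
      doubleInt_const_mul hp0 MeasurableSet.univ hs.le, h2]

lemma bddBelow_energy (hN : 3 < N) (hμN : μ < N) : BddBelow (energy μ '' nehari N μ) := by
  refine ⟨0, ?_⟩
  rintro _ ⟨u, hu, rfl⟩
  have h := mul_nonneg (half_sub_pos (one_lt_critExp hN hμN)).le
    (doubleInt_nonneg (μ := μ) (Ω := Set.univ) (u := u))
  rw [energy, hu.2.2]
  linarith

lemma energyOn_eq (hv : v ∈ nehariOn μ lam Ω) :
    energyOn μ lam Ω v = (1 / 2 - 1 / (2 * critExp N μ)) * doubleInt μ Ω v := by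
  have h := hv.2.2
  rw [energyOn, ← h]
  ring

lemma bddBelow_energyOn (hN : 3 < N) (hμN : μ < N) :
    BddBelow (energyOn μ lam Ω '' nehariOn μ lam Ω) := by
  refine ⟨0, ?_⟩
  rintro _ ⟨u, hu, rfl⟩
  rw [energyOn_eq hu]
  exact mul_nonneg (half_sub_pos (one_lt_critExp hN hμN)).le doubleInt_nonneg

lemma level_le_projLevel (hN : 3 < N) (hμN : μ < N)
    (h : ClosureTestWith (sobolevExp N) Set.univ u g) (hB : 0 < doubleInt μ Set.univ u) :
    level N μ ≤ projLevel (critExp N μ) (dirichlet Set.univ u) (doubleInt μ Set.univ u) := by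
  obtain ⟨w, hw, he⟩ := exists_nehari_energy_eq hN hμN h hB
  rw [← he]
  exact csInf_le (bddBelow_energy hN hμN) ⟨w, hw, rfl⟩

lemma ClosureTestWith.dirichlet_pos_of_open (hN : 3 < N) (hΩ : IsOpen Ω)
    (h : ClosureTestWith 2 Ω v g) (hv : ¬ v =ᵐ[volume.restrict Ω] 0) : 0 < dirichlet Ω v := by
  rw [← h.dirichlet_indicator hN hΩ]
  refine (h.extend hN hΩ).dirichlet_pos hN fun h0 => hv ?_
  rw [Filter.EventuallyEq, ae_restrict_iff' hΩ.measurableSet]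
  filter_upwards [h0] with x hx hxΩ
  rwa [Set.indicator_of_mem hxΩ] at hx

lemma exists_nehariOn_energyOn_eq (hN : 3 < N) (hμN : μ < N) (hlam : 0 ≤ lam) (hΩ : IsOpen Ω)
    (h : ClosureTestWith 2 Ω v g) (hB : 0 < doubleInt μ Ω v) :
    ∃ w ∈ nehariOn μ lam Ω, energyOn μ lam Ω w
      = projLevel (critExp N μ) (dirichlet Ω v + lam * ∫ x in Ω, v x ^ 2) (doubleInt μ Ω v) := by
  have hp := one_lt_critExp hN hμN
  have hp0 : critExp N μ ≠ 0 := by linarith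
  have hv : ¬ v =ᵐ[volume.restrict Ω] 0 := fun h0 => hB.ne' (doubleInt_eq_zero_of_ae hp0 h0)
  have hL : 0 ≤ lam * ∫ x in Ω, v x ^ 2 := mul_nonneg hlam (integral_nonneg fun x => sq_nonneg _)
  have hQ : 0 < dirichlet Ω v + lam * ∫ x in Ω, v x ^ 2 := by
    linarith [h.dirichlet_pos_of_open hN hΩ hv]
  obtain ⟨s, hs, h1, h2⟩ := exists_scaling hp hQ hB
  have h3 : ∫ x in Ω, (s * v x) ^ 2 = s ^ 2 * ∫ x in Ω, v x ^ 2 := by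
    rw [← integral_const_mul]
    simp only [mul_pow]
  refine ⟨fun x => s * v x, ⟨memClosureTest_iff.2 ⟨_, h.const_mul s⟩,
    not_ae_zero_const_mul hs hv, ?_⟩, ?_⟩
  · rw [h.hasWeakGradient.dirichlet_const_mul hΩ, doubleInt_const_mul hp0 hΩ.measurableSet hs.le,
      h3, ← h1]
    ring
  · rw [energyOn, h.hasWeakGradient.dirichlet_const_mul hΩ,
      doubleInt_const_mul hp0 hΩ.measurableSet hs.le, h3, ← h2]
    ring

lemma levelOn_le_projLevel (hN : 3 < N) (hμN : μ < N) (hlam : 0 ≤ lam) (hΩ : IsOpen Ω)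
    (h : ClosureTestWith 2 Ω v g) (hB : 0 < doubleInt μ Ω v) :
    levelOn μ lam Ω
      ≤ projLevel (critExp N μ) (dirichlet Ω v + lam * ∫ x in Ω, v x ^ 2) (doubleInt μ Ω v) := by
  obtain ⟨w, hw, he⟩ := exists_nehariOn_energyOn_eq hN hμN hlam hΩ h hB
  rw [← he]
  exact csInf_le (bddBelow_energyOn hN hμN) ⟨w, hw, rfl⟩

/-! ### Comparison of the two levels -/

/-- On the Nehari manifold of `Ω`, the nonlocal energy is positive and bounds the Dirichlet
integral. -/
lemma doubleInt_pos_of_mem_nehariOn (hN : 3 < N) (hlam : 0 ≤ lam) (hΩ : IsOpen Ω)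
    (hv : v ∈ nehariOn μ lam Ω) : 0 < doubleInt μ Ω v ∧ dirichlet Ω v ≤ doubleInt μ Ω v := by
  obtain ⟨h1, h2, h3⟩ := hv
  obtain ⟨g, h⟩ := memClosureTest_iff.1 h1
  have hL : 0 ≤ lam * ∫ x in Ω, v x ^ 2 := mul_nonneg hlam (integral_nonneg fun x => sq_nonneg _)
  have := h.dirichlet_pos_of_open hN hΩ h2
  constructor <;> linarith

lemma level_le_levelOn (hN : 3 < N) (hμN : μ < N) (hlam : 0 ≤ lam) (hΩ : IsOpen Ω)
    (hne : (nehariOn μ lam Ω).Nonempty) : level N μ ≤ levelOn μ lam Ω := by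
  have hp := one_lt_critExp hN hμN
  have hp0 : critExp N μ ≠ 0 := by linarith
  refine le_csInf (hne.image _) ?_
  rintro _ ⟨v, hv, rfl⟩
  obtain ⟨g, h⟩ := memClosureTest_iff.1 hv.1
  obtain ⟨hB, hD⟩ := doubleInt_pos_of_mem_nehariOn hN hlam hΩ hv
  have hl := level_le_projLevel hN hμN (h.extend hN hΩ) (μ := μ)
    (by rwa [doubleInt_univ_indicator hp0 hΩ.measurableSet])
  rw [h.dirichlet_indicator hN hΩ, doubleInt_univ_indicator hp0 hΩ.measurableSet] at hl
  rw [energyOn_eq hv, ← projLevel_self hB.ne']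
  exact hl.trans (projLevel_mono hp (integral_nonneg fun x => by positivity) hD hB le_rfl)

lemma IsTest.dirichlet_eq (hu : IsTest Ω u) (hΩ : IsOpen Ω) :
    dirichlet Ω u = ∫ x, ‖gradient u x‖ ^ 2 := by
  rw [(hu.to_univ.hasWeakGradient Ω).dirichlet_eq hΩ]
  exact setIntegral_eq_integral_of_forall_compl_eq_zero fun x hx => by
    simp [hu.gradient_eq_zero hx]

lemma IsTest.indicator_eq (hu : IsTest Ω u) : Ω.indicator u = u :=
  Set.indicator_eq_self.2 fun x hx => by
    by_contra hxΩ
    exact hx (hu.eq_zero hxΩ)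

/-- For `σ` large, the dilation `x ↦ u (σ (x - a))` of a test function on the whole space is
supported near `a`. -/
lemma IsTest.eventually_dilation (hu : IsTest Set.univ u) (hΩ : IsOpen Ω)
    {a : EuclideanSpace ℝ (Fin N)} (ha : a ∈ Ω) :
    ∀ᶠ σ : ℝ in atTop, IsTest Ω (fun x => u (σ • (x - a))) := by
  obtain ⟨r, hr, hball⟩ := Metric.isOpen_iff.1 hΩ a ha
  obtain ⟨R, hR⟩ := hu.2.1.isBounded.subset_closedBall (0 : EuclideanSpace ℝ (Fin N))
  have h1 : Tendsto (fun σ : ℝ => σ * r) atTop atTop := tendsto_id.atTop_mul_const hr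
  filter_upwards [eventually_gt_atTop 0, h1.eventually_gt_atTop R] with σ hσ hσr
  have hsub : tsupport (fun x => u (σ • (x - a))) ⊆ Metric.closedBall a (R / σ) := by
    refine closure_minimal (fun x hx => ?_) Metric.isClosed_closedBall
    have h2 := hR (subset_tsupport u hx)
    rw [mem_closedBall_zero_iff, norm_smul, Real.norm_of_nonneg hσ.le] at h2
    rw [mem_closedBall_iff_norm, le_div_iff₀ hσ]
    linarith
  have hsmooth : ContDiff ℝ ∞ fun x : EuclideanSpace ℝ (Fin N) => σ • (x - a) := by fun_prop
  refine ⟨hu.1.comp hsmooth, ?_, ?_⟩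
  · exact (isCompact_closedBall a (R / σ)).of_isClosed_subset (isClosed_tsupport _) hsub
  · refine hsub.trans (subset_trans (Metric.closedBall_subset_ball ?_) hball)
    rw [div_lt_iff₀ hσ]
    linarith

lemma IsTest.gradient_dilation (hu : IsTest Set.univ u) (σ : ℝ) (a x : EuclideanSpace ℝ (Fin N)) :
    gradient (fun x => u (σ • (x - a))) x = σ • gradient u (σ • (x - a)) := by
  have h1 : HasFDerivAt (fun x : EuclideanSpace ℝ (Fin N) => σ • (x - a))
      (σ • ContinuousLinearMap.id ℝ (EuclideanSpace ℝ (Fin N))) x :=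
    ((hasFDerivAt_id x).sub_const a).const_smul σ
  have h2 := ((hu.differentiable (σ • (x - a))).hasFDerivAt.comp x h1).fderiv
  refine ext_inner_right ℝ fun e => ?_
  rw [inner_gradient_left, inner_smul_left, inner_gradient_left]
  change fderiv ℝ (u ∘ fun x => σ • (x - a)) x e = _
  rw [h2]
  simp

lemma integral_comp_dilation {σ : ℝ} (hσ : 0 < σ) (a : EuclideanSpace ℝ (Fin N))
    (f : EuclideanSpace ℝ (Fin N) → ℝ) :
    ∫ x, f (σ • (x - a)) = (σ ^ N)⁻¹ * ∫ x, f x := by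
  rw [integral_sub_right_eq_self (fun x => f (σ • x)) a,
    Measure.integral_comp_smul_of_nonneg volume f σ (hR := hσ.le)]
  simp

/-- Concentrating a test function at a point of `Ω` makes the contribution of the term
`lam * ∫ u²` disappear and leaves all other quantities invariant. -/
lemma levelOn_le_projLevel_of_isTest (hN : 3 < N) (hμN : μ < N) (hlam : 0 ≤ lam)
    (hΩ : IsOpen Ω) {a : EuclideanSpace ℝ (Fin N)} (ha : a ∈ Ω) (hu : IsTest Set.univ u)
    (hB : 0 < doubleInt μ Set.univ u) :
    levelOn μ lam Ω
      ≤ projLevel (critExp N μ) (dirichlet Set.univ u) (doubleInt μ Set.univ u) := by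
  have hp := one_lt_critExp hN hμN
  have hp0 : critExp N μ ≠ 0 := by linarith
  have h3 : (3 : ℝ) < N := by exact_mod_cast hN
  set D := dirichlet Set.univ u with hD
  set B := doubleInt μ Set.univ u
  set I := ∫ x, u x ^ 2 with hI
  have hD0 : 0 ≤ D := integral_nonneg fun x => by positivity
  have hI0 : 0 ≤ I := integral_nonneg fun x => sq_nonneg _
  have hlim : Tendsto (fun σ : ℝ => projLevel (critExp N μ) (D + lam * ((σ ^ 2)⁻¹ * I)) B) atTop
      (𝓝 (projLevel (critExp N μ) D B)) := by
    have h1 : Tendsto (fun σ : ℝ => (σ ^ 2)⁻¹) atTop (𝓝 0) :=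
      (tendsto_pow_atTop two_ne_zero).inv_tendsto_atTop
    have h2 : Tendsto (fun σ : ℝ => D + lam * ((σ ^ 2)⁻¹ * I)) atTop (𝓝 D) := by
      simpa using ((h1.mul_const I).const_mul lam).const_add D
    exact tendsto_projLevel hp hB.ne' h2 tendsto_const_nhds
  refine ge_of_tendsto hlim ?_
  filter_upwards [hu.eventually_dilation hΩ ha, eventually_gt_atTop 0] with σ ht hσ
  have eD : dirichlet Ω (fun x => u (σ • (x - a))) = σ ^ 2 * (σ ^ N)⁻¹ * D := by
    rw [ht.dirichlet_eq hΩ, hD, hu.dirichlet_eq isOpen_univ, mul_assoc,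
      ← integral_comp_dilation hσ a (fun x => ‖gradient u x‖ ^ 2), ← integral_const_mul]
    refine integral_congr_ae (ae_of_all _ fun x => ?_)
    simp only [hu.gradient_dilation σ a x, norm_smul, mul_pow, Real.norm_eq_abs, sq_abs]
  have eI : ∫ x in Ω, u (σ • (x - a)) ^ 2 = (σ ^ N)⁻¹ * I := by
    rw [hI, ← integral_comp_dilation hσ a (fun x => u x ^ 2)]
    exact setIntegral_eq_integral_of_forall_compl_eq_zero fun x hx => by
      simp [ht.eq_zero hx]
  have eB : doubleInt μ Ω (fun x => u (σ • (x - a)))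
      = (σ ^ 2 * (σ ^ N)⁻¹) ^ critExp N μ * B := by
    rw [← doubleInt_univ_indicator hp0 hΩ.measurableSet, ht.indicator_eq,
      doubleInt_comp_dilation hp0 hσ]
    congr 1
    have e1 : σ ^ 2 * (σ ^ N)⁻¹ = σ ^ (2 - N : ℝ) := by
      rw [Real.rpow_sub hσ, Real.rpow_natCast, Real.rpow_ofNat, div_eq_mul_inv]
    have e2 : ((σ ^ N)⁻¹) ^ 2 = σ ^ (-(2 * N) : ℝ) := by
      rw [Real.rpow_neg hσ.le, mul_comm, Real.rpow_mul hσ.le, Real.rpow_natCast, Real.rpow_ofNat,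
        inv_pow]
    rw [e1, e2, ← Real.rpow_mul hσ.le, ← Real.rpow_add hσ, critExp]
    congr 1
    have : (N : ℝ) - 2 ≠ 0 := by linarith
    field_simp
    ring
  have hpos : 0 < σ ^ 2 * (σ ^ N)⁻¹ := by positivity
  have h4 := levelOn_le_projLevel (lam := lam) (μ := μ) hN hμN hlam hΩ (ht.closureTestWith 2)
    (by rw [eB]; positivity)
  rw [eD, eI, eB] at h4
  have e5 : σ ^ 2 * (σ ^ N)⁻¹ * D + lam * ((σ ^ N)⁻¹ * I)
      = σ ^ 2 * (σ ^ N)⁻¹ * (D + lam * ((σ ^ 2)⁻¹ * I)) := by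
    field_simp
  rwa [e5, projLevel_scale hp hpos (by positivity) hB.le] at h4

lemma tendsto_integral_norm_sq {α F : Type*} [MeasurableSpace α] {ν : Measure α}
    [NormedAddCommGroup F] [InnerProductSpace ℝ F]
    {f : ℕ → α → F} {w : α → F} (hf : ∀ n, MemLp (f n) 2 ν) (hw : MemLp w 2 ν)
    (h : Tendsto (fun n => eLpNorm (fun x => f n x - w x) 2 ν) atTop (𝓝 0)) :
    Tendsto (fun n => ∫ x, ‖f n x‖ ^ 2 ∂ν) atTop (𝓝 (∫ x, ‖w x‖ ^ 2 ∂ν)) := by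
  have key : ∀ {a : α → F} (ha : MemLp a 2 ν), ∫ x, ‖a x‖ ^ 2 ∂ν = ‖ha.toLp a‖ ^ 2 :=
    fun {a} ha => by
      rw [← real_inner_self_eq_norm_sq, L2.inner_def]
      refine integral_congr_ae ?_
      filter_upwards [ha.coeFn_toLp] with x h1
      rw [h1, real_inner_self_eq_norm_sq]
  simp only [key (hf _), key hw]
  refine (Tendsto.norm ?_).pow 2
  rw [Lp.tendsto_Lp_iff_tendsto_eLpNorm'']
  exact h

lemma levelOn_le_level (hN : 3 < N) (hμ : 0 ≤ μ) (hμN : μ < N) (hlam : 0 ≤ lam) (hΩ : IsOpen Ω)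
    {a : EuclideanSpace ℝ (Fin N)} (ha : a ∈ Ω) (hne : (nehari N μ).Nonempty) :
    levelOn μ lam Ω ≤ level N μ := by
  have hp := one_lt_critExp hN hμN
  have hp0 : critExp N μ ≠ 0 := by linarith
  refine le_csInf (hne.image _) ?_
  rintro _ ⟨u, ⟨h1, h2, h3⟩, rfl⟩
  obtain ⟨g, h⟩ := memClosureTest_iff.1 h1
  have hD := h.dirichlet_pos hN h2
  obtain ⟨φ, hφ, hlim, hglim⟩ := h.approx
  have hu := h.memLp
  have hg := h.memLp_grad
  rw [Measure.restrict_univ] at hlim hglim hu hg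
  set B := doubleInt μ Set.univ u with hB
  have hB0 : 0 < B := by linarith
  have h0 : sobolevExp N ≠ 0 := fun h0 => by simpa [h0] using two_le_sobolevExp hN
  obtain ⟨ns, hns, hae⟩ := (tendstoInMeasure_of_tendsto_eLpNorm h0
    (fun n => ((hφ n).memLp (sobolevExp N)).aestronglyMeasurable) hu.1 hlim).exists_seq_tendsto_ae
  have hfatou := doubleLint_le_liminf (μ := μ) (by linarith) (fun n => (hφ (ns n)).continuous) hae
  have hDlim : Tendsto (fun n => dirichlet Set.univ (φ (ns n))) atTop (𝓝 B) := by
    have := tendsto_integral_norm_sq (fun n => (hφ n).memLp_gradient 2) hg hglim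
    rw [← h3, h.hasWeakGradient.dirichlet_eq isOpen_univ, Measure.restrict_univ]
    refine (this.comp hns.tendsto_atTop).congr fun n => ?_
    rw [Function.comp, (hφ _).dirichlet_eq isOpen_univ]
  have hen : energy μ u = projLevel (critExp N μ) B B := by
    rw [energy, h3, projLevel_self hB0.ne']
    ring
  -- by lower semicontinuity, the nonlocal energies of the `φ n` eventually exceed any `b < B`
  have hb : ∀ b : ℝ, 0 < b → b < B → levelOn μ lam Ω ≤ projLevel (critExp N μ) B b := by
    intro b hb0 hbB
    have hlt : ENNReal.ofReal b < doubleLint μ u := by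
      rw [hB, doubleInt_univ hp0] at hbB
      exact ENNReal.ofReal_lt_iff_lt_toReal hb0.le
        (fun htop => by rw [htop] at hbB; simp at hbB; linarith) |>.2 hbB
    have hev := eventually_lt_of_lt_liminf (hlt.trans_le hfatou)
    have hl : Tendsto (fun n => projLevel (critExp N μ) (dirichlet Set.univ (φ (ns n))) b) atTop
        (𝓝 (projLevel (critExp N μ) B b)) :=
      tendsto_projLevel hp hb0.ne' hDlim tendsto_const_nhds
    refine ge_of_tendsto hl ?_
    filter_upwards [hev] with n hn
    have hn' : b < doubleInt μ Set.univ (φ (ns n)) := by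
      rw [doubleInt_univ hp0]
      exact (ENNReal.ofReal_lt_iff_lt_toReal hb0.le
        ((hφ (ns n)).doubleLint_lt_top hN hμ hμN).ne).1 hn
    exact (levelOn_le_projLevel_of_isTest hN hμN hlam hΩ ha (hφ _) (hb0.trans hn')).trans
      (projLevel_mono hp (integral_nonneg fun x => by positivity) le_rfl hb0 hn'.le)
  rw [hen]
  have hl : Tendsto (fun b => projLevel (critExp N μ) B b) (𝓝[<] B)
      (𝓝 (projLevel (critExp N μ) B B)) :=
    tendsto_projLevel hp hB0.ne' tendsto_const_nhds
      (tendsto_nhdsWithin_of_tendsto_nhds tendsto_id)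
  refine ge_of_tendsto hl ?_
  filter_upwards [Ioo_mem_nhdsLT hB0] with b hb' using hb b hb'.1 hb'.2

end Nehari

/-! ### The level is not achieved -/

section

variable {μ lam : ℝ} {Ω : Set (EuclideanSpace ℝ (Fin N))} {v : EuclideanSpace ℝ (Fin N) → ℝ}

/-- A test function that equals `1` on a neighbourhood of a bounded set. -/
lemma exists_isTest_eq_one (hbdd : Bornology.IsBounded Ω) :
    ∃ φ : EuclideanSpace ℝ (Fin N) → ℝ, IsTest Set.univ φ ∧ (∀ x, 0 ≤ φ x) ∧
      (∀ x ∈ Ω, φ x = 1) ∧ ∀ x ∈ Ω, gradient φ x = 0 := by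
  obtain ⟨R, hR0, hR⟩ := hbdd.subset_ball_lt 0 (0 : EuclideanSpace ℝ (Fin N))
  let f : ContDiffBump (0 : EuclideanSpace ℝ (Fin N)) :=
    { rIn := R, rOut := R + 1, rIn_pos := hR0, rIn_lt_rOut := by linarith }
  refine ⟨f, ⟨f.contDiff, f.hasCompactSupport, Set.subset_univ _⟩, fun x => f.nonneg,
    fun x hx => f.one_of_mem_closedBall (Metric.ball_subset_closedBall (hR hx)), fun x hx => ?_⟩
  have h1 : f =ᶠ[𝓝 x] fun _ => (1 : ℝ) := f.eventuallyEq_one_of_mem_ball (hR hx)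
  rw [gradient, h1.fderiv_eq]
  simp

/-- The Dirichlet integrals of functions whose gradients live on disjoint sets add up. -/
lemma ClosureTestWith.dirichlet_add_const_mul {p : ENNReal}
    {w φ : EuclideanSpace ℝ (Fin N) → ℝ}
    {g : EuclideanSpace ℝ (Fin N) → EuclideanSpace ℝ (Fin N)}
    (h : ClosureTestWith p Set.univ w g) (hφ : IsTest Set.univ φ)
    (hdisj : ∀ x, g x = 0 ∨ gradient φ x = 0) (t : ℝ) :
    dirichlet Set.univ (fun x => w x + t * φ x)
      = dirichlet Set.univ w + t ^ 2 * dirichlet Set.univ φ := by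
  have hg := h.memLp_grad
  rw [Measure.restrict_univ] at hg
  rw [(h.add_test (hφ.const_mul t)).hasWeakGradient.dirichlet_eq isOpen_univ,
    h.hasWeakGradient.dirichlet_eq isOpen_univ, hφ.dirichlet_eq isOpen_univ,
    Measure.restrict_univ, ← integral_const_mul, ← integral_add hg.norm.integrable_sq
      ((hφ.memLp_gradient 2).norm.integrable_sq.const_mul _)]
  refine integral_congr_ae (ae_of_all _ fun x => ?_)
  simp only [hφ.gradient_const_mul]
  rcases hdisj x with hx | hx <;> simp [hx, norm_smul, mul_pow]

/-- An element of the Nehari manifold of `Ω` at the level of the whole space would, extended by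
zero, minimize `projLevel` on the whole space. Raising it by `t` on `Ω` increases the Dirichlet integral to second order in `t` only, but the nonlocal energy
to first order. -/
lemma energyOn_ne_level (hN : 3 < N) (hμ : 0 ≤ μ) (hμN : μ < N) (hlam : 0 ≤ lam) (hΩ : IsOpen Ω)
    (hbdd : Bornology.IsBounded Ω) (hv : v ∈ nehariOn μ lam Ω) :
    energyOn μ lam Ω v ≠ level N μ := by
  intro heq
  have hp := one_lt_critExp hN hμN
  have hp0 : critExp N μ ≠ 0 := by linarith
  have hm := hΩ.measurableSet
  obtain ⟨g, h⟩ := memClosureTest_iff.1 hv.1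
  obtain ⟨hB, hD⟩ := doubleInt_pos_of_mem_nehariOn hN hlam hΩ hv
  have hw := h.extend hN hΩ
  have hwLp := hw.memLp
  rw [Measure.restrict_univ] at hwLp
  obtain ⟨φ, hφ, hφ0, hφ1, hφg⟩ := exists_isTest_eq_one hbdd
  -- the nonlocal energy is finite, since its `toReal` is not the junk value `0`
  have hfin : doubleLint μ (Ω.indicator v) ≠ ⊤ := fun htop => by
    rw [doubleInt_eq hp0 hm, htop] at hB
    simp at hB
  have hBw := doubleInt_univ_indicator (u := v) hp0 hm
  obtain ⟨c, hc, hct⟩ := exists_doubleInt_add_ge hN hμ hμN hm hbdd.measure_lt_top.ne hwLp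
    (fun x hx => Set.indicator_of_notMem hx v) hfin (by rwa [hBw]) hφ hφ0 hφ1
  obtain ⟨t, ht0, ht1, hlt⟩ := exists_projLevel_lt (C := dirichlet Set.univ φ) hp hB
    (integral_nonneg fun x => by positivity) hc
  have hBt := hct t ht0 ht1
  rw [hBw] at hBt
  have hBpos : 0 < doubleInt μ Ω v + c * t := by positivity
  have hl := level_le_projLevel hN hμN (hw.add_test (hφ.const_mul t)) (hBpos.trans_le hBt)
  have hdisj : ∀ x, Ω.indicator g x = 0 ∨ gradient φ x = 0 := fun x => by
    by_cases hx : x ∈ Ω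
    · exact Or.inr (hφg x hx)
    · exact Or.inl (Set.indicator_of_notMem hx g)
  have hDt := hw.dirichlet_add_const_mul hφ hdisj t
  rw [h.dirichlet_indicator hN hΩ] at hDt
  have hmono := projLevel_mono hp (integral_nonneg fun x => by positivity)
    (by rw [hDt]; linarith : dirichlet Set.univ (fun x => Ω.indicator v x + t * φ x)
      ≤ doubleInt μ Ω v + t ^ 2 * dirichlet Set.univ φ) hBpos hBt
  rw [← heq, energyOn_eq hv, ← projLevel_self hB.ne'] at hl
  exact absurd (hl.trans hmono) (not_le.2 hlt)

lemma exists_isTest_pos (hΩ : IsOpen Ω) {a : EuclideanSpace ℝ (Fin N)} (ha : a ∈ Ω) :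
    ∃ φ : EuclideanSpace ℝ (Fin N) → ℝ, IsTest Ω φ ∧ 0 < φ a := by
  obtain ⟨φ, h1, h2, h3, -, h4⟩ := exists_contDiff_tsupport_subset (n := ⊤) (hΩ.mem_nhds ha)
  exact ⟨φ, ⟨h3, h2, h1⟩, by rw [h4]; exact one_pos⟩

end

end Choquard

theorem lemma4p4 (N : ℕ) (hN : 3 < N) (μ lam : ℝ) (hμ0 : 0 < μ) (hμN : μ < N) (hlam : 0 ≤ lam)
    (Ω : Set (EuclideanSpace ℝ (Fin N))) (hopen : IsOpen Ω) (hconn : IsConnected Ω)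
    (hbdd : Bornology.IsBounded Ω) :
    -- both levels are infima of nonempty sets of reals that are bounded below
    (Choquard.nehari N μ).Nonempty ∧
    BddBelow (Choquard.energy μ '' Choquard.nehari N μ) ∧
    (Choquard.nehariOn μ lam Ω).Nonempty ∧
    BddBelow (Choquard.energyOn μ lam Ω '' Choquard.nehariOn μ lam Ω) ∧
    -- they are equal
    Choquard.levelOn μ lam Ω = Choquard.level N μ ∧
    -- the level on `Ω` is not achieved
    ¬ ∃ v ∈ Choquard.nehariOn μ lam Ω,
      Choquard.energyOn μ lam Ω v = Choquard.levelOn μ lam Ω := by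
  obtain ⟨a, ha⟩ := hconn.nonempty
  obtain ⟨φ, hφ, hφa⟩ := Choquard.exists_isTest_pos hopen ha
  have hp := Choquard.one_lt_critExp hN hμN
  have hB := hφ.doubleInt_pos hN hμ0.le hμN hφa
  have hBΩ : 0 < Choquard.doubleInt μ Ω φ := by
    rwa [← Choquard.doubleInt_univ_indicator (by linarith) hopen.measurableSet, hφ.indicator_eq]
  obtain ⟨w, hw, -⟩ := Choquard.exists_nehari_energy_eq hN hμN (hφ.to_univ.closureTestWith _) hB
  obtain ⟨v, hv, -⟩ :=
    Choquard.exists_nehariOn_energyOn_eq hN hμN hlam hopen (hφ.closureTestWith 2) hBΩ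
  have heq : Choquard.levelOn μ lam Ω = Choquard.level N μ :=
    le_antisymm (Choquard.levelOn_le_level hN hμ0.le hμN hlam hopen ha ⟨w, hw⟩)
      (Choquard.level_le_levelOn hN hμN hlam hopen ⟨v, hv⟩)
  refine ⟨⟨w, hw⟩, Choquard.bddBelow_energy hN hμN, ⟨v, hv⟩, Choquard.bddBelow_energyOn hN hμN,
    heq, ?_⟩
  rintro ⟨v, hv, hve⟩
  exact Choquard.energyOn_ne_level hN hμ0.le hμN hlam hopen hbdd hv (hve.trans heq)
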